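/- Let $m,n\ge 0$ be integers. The free hexagonal lattice $H^f(m,n)$ is the simple graph on the $2(m+1)(n+1)$ vertices $A_{i,j},B_{i,j}$ ($0\le i\le m$, $0\le j\le n$) in which $A_{i,j}$ is joined to $B_{i,j}$, to $B_{i,j-1}$ (if $j\ge1$) and to $B_{i-1,j}$ (if $i\ge1$). The cylindrical hexagonal lattice $H^c(m,n)$ arises from $H^f(m,n)$ by adding the edges $A_{i,0}B_{i,n}$ ($0\le i\le m$), and the toroidal hexagonal lattice $H^t(m,n)$ arises from $H^c(m,n)$ by adding the edges $A_{0,j}B_{m,j}$ ($0\le j\le n$); an edge that is already present is not doubled. For a finite graph $G$ with $N$ vertices and Laplacian eigenvalues $\mu_1\ge\mu_2\ge\dots\ge\mu_N=0$, counted with multiplicity, let $LEL(G)=\sum_{i=1}^{N-1}\sqrt{\mu_i}$ (the Laplacian-energy-like invariant). Put $$h=\frac1{8\pi^2}\int_0^{2\pi}\!\!\int_0^{2\pi}\sqrt{3+\sqrt{3+2\cos x+2\cos y+2\cos(x+y)}}\,dy\,dx+\frac1{8\pi^2}\int_0^{2\pi}\!\!\int_0^{2\pi}\sqrt{3-\sqrt{3+2\cos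 x+2\cos y+2\cos(x+y)}}\,dy\,dx .$$ **Theorem 4.1.** 1. The following iterated limits exist (for every $m$ the inner limit exists, and so does the outer one) and $$\lim_{m\to\infty}\lim_{n\to\infty}\frac{LEL(H^t(m,n))}{2(m+1)(n+1)}=\lim_{m\to\infty}\lim_{n\to\infty}\frac{LEL(H^c(m,n))}{2(m+1)(n+1)}=\lim_{m\to\infty}\lim_{n\to\infty}\frac{LEL(H^f(m,n))}{2(m+1)(n+1)}=h\approx 1.6357,$$ where $\approx$ means $|h-1.6357|\le 5\cdot10^{-5}$. 2. As $m$ and $n$ tend to infinity, independently of each other, each of $LEL(H^t(m,n))$, $LEL(H^c(m,n))$ and $LEL(H^f(m,n))$ is asymptotically equivalent to $2h\,(m+1)(n+1)$ (the ratio tends to $1$), and $2h\approx 3.2714$, that is, $|2h-3.2714|\le 5\cdot10^{-5}$. -/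

import Mathlib

open Filter Topology Asymptotics

open scoped Classical in
/-- The Laplacian-energy-like invariant of a finite graph on `N` vertices: the sum of the square
roots of the `N - 1` largest Laplacian eigenvalues `μ₁ ≥ μ₂ ≥ ⋯ ≥ μ_N`, counted with multiplicity.
`eigenvalues₀` lists all `N` eigenvalues in decreasing order, indexed from `0`. -/
noncomputable def LEL {V : Type*} [Fintype V] (G : SimpleGraph V) : ℝ :=
  ∑ i ∈ Finset.univ.filter (fun i : Fin (Fintype.card V) => (i : ℕ) + 1 < Fintype.card V),
    √((SimpleGraph.posSemidef_lapMatrix ℝ G).isHermitian.eigenvalues₀ i)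

/-- The `2 (m + 1) (n + 1)` vertices of the hexagonal lattices: cells `(i, j)` with `0 ≤ i ≤ m`,
`0 ≤ j ≤ n`, each holding one vertex `A (i, j) = (i, j, false)` of the first sublattice and one
vertex `B (i, j) = (i, j, true)` of the second. -/
abbrev HexVertex (m n : ℕ) : Type := Fin (m + 1) × Fin (n + 1) × Bool

/-- The bonds of the free hexagonal lattice, directed from the `A`-vertex to the `B`-vertex:
`A (i, j)` is joined to `B (i, j)`, `B (i, j - 1)` and `B (i - 1, j)`, whenever these exist.
So row `i` is the zigzag path `A (i, 0), B (i, 0), A (i, 1), B (i, 1), …, A (i, n), B (i, n)`. -/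
def hexBond (m n : ℕ) : HexVertex m n → HexVertex m n → Prop
  | (i, j, false), (i', j', true) =>
      (i = i' ∧ j = j') ∨ (i = i' ∧ (j : ℕ) = j' + 1) ∨ ((i : ℕ) = i' + 1 ∧ j = j')
  | _, _ => False

/-- The `m + 1` bonds that close each row to a cycle: `A (i, 0)` to `B (i, n)`. -/
def hexRowClosing (m n : ℕ) : HexVertex m n → HexVertex m n → Prop
  | (i, j, false), (i', j', true) => i = i' ∧ j = 0 ∧ j' = Fin.last n
  | _, _ => False

/-- The `n + 1` bonds that join the first row to the last row: `A (0, j)` to `B (m, j)`. -/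
def hexColClosing (m n : ℕ) : HexVertex m n → HexVertex m n → Prop
  | (i, j, false), (i', j', true) => j = j' ∧ i = 0 ∧ i' = Fin.last m
  | _, _ => False

/-- The hexagonal lattice with free boundary condition. -/
def hexFree (m n : ℕ) : SimpleGraph (HexVertex m n) :=
  SimpleGraph.fromRel (hexBond m n)

/-- The hexagonal lattice with cylindrical boundary condition. -/
def hexCylinder (m n : ℕ) : SimpleGraph (HexVertex m n) :=
  hexFree m n ⊔ SimpleGraph.fromRel (hexRowClosing m n)

/-- The hexagonal lattice with toroidal boundary condition. -/
def hexTorus (m n : ℕ) : SimpleGraph (HexVertex m n) :=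
  hexCylinder m n ⊔ SimpleGraph.fromRel (hexColClosing m n)

/-- `lim_{m → ∞} lim_{n → ∞} f m n = L`; all the limits are required to exist. -/
def HasIteratedLimit (f : ℕ → ℕ → ℝ) (L : ℝ) : Prop :=
  ∃ g : ℕ → ℝ, (∀ m, Tendsto (f m) atTop (𝓝 (g m))) ∧ Tendsto g atTop (𝓝 L)

/-- The asymptotic Laplacian-energy-like per vertex of the hexagonal lattice, as an integral. -/
noncomputable def hexLELDensity : ℝ :=
  1 / (8 * Real.pi ^ 2) * (∫ x in (0 : ℝ)..2 * Real.pi, ∫ y in (0 : ℝ)..2 * Real.pi,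
      √(3 + √(3 + 2 * Real.cos x + 2 * Real.cos y + 2 * Real.cos (x + y)))) +
  1 / (8 * Real.pi ^ 2) * (∫ x in (0 : ℝ)..2 * Real.pi, ∫ y in (0 : ℝ)..2 * Real.pi,
      √(3 - √(3 + 2 * Real.cos x + 2 * Real.cos y + 2 * Real.cos (x + y))))

/-! ### Comparing sums of square roots of eigenvalues -/

section EigenvalueSums

open Matrix

variable {ι : Type*} [Fintype ι] [DecidableEq ι] {A B : Matrix ι ι ℝ}

/-! The torus is translation invariant, so its Laplacian is diagonalised explicitly. For `m, n ≥ 1`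
the discrete Fourier transform splits it into 2×2 blocks with eigenvalues `3 ± √D`, where `D = 3 + 2
cos x + 2 cos y + 2 cos (x + y)` and `(x, y)` runs through a grid (`LEL_hexTorus`). The normalised
invariant is thus a Riemann sum of a continuous function and converges to `h` jointly in `m` and
`n`.

The other two lattices differ from the torus by boundary bonds, which are negligible. Concavity of
the square root gives a trace inequality (`sum_sqrt_eigenvalues_le`): the invariant is monotone
under adding edges, and `c` new bonds on `N` vertices raise it by at most `N t + c / t` for every `t
> 0`. With an optimised `t` this is of smaller order than the number of vertices, so all three joint
limits agree, and asymptotic equivalence follows because `h ≠ 0`. The iterated limits also need the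
inner limits for fixed `m`. Those come from Fekete's lemma, since a long strip contains two disjoint
shorter ones, and from negligible closing bonds.

For the numerical value, `h = √3 · mean F(D / 9)` with `F r = √((1 + √(1 - r)) / 2)`. All Taylor
coefficients of `F` at `0` except the constant one are nonpositive. Hence a polynomial of low enough
degree that touches `F` to first order at interior nodes lies above `F`, and with one more degree
and a value at `1` not exceeding `F 1` it lies below (`HasNonnegTail.nonneg_of_double_zeros`,
`HasNonnegTail.nonpos_of_double_zeros`). The moments of `D` are integers given by binomial sums
(`periodMean_hexDispersion_pow`), so the means of both polynomials are rational numbers that the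
kernel evaluates. -/

theorem Matrix.IsHermitian.dotProduct_mulVec_eq_sum_eigenvalues (hA : A.IsHermitian)
    (w : EuclideanSpace ℝ ι) :
    w.ofLp ⬝ᵥ A *ᵥ w.ofLp =
      ∑ i, hA.eigenvalues i * inner ℝ (hA.eigenvectorBasis i) w ^ 2 := by
  have h1 : w.ofLp ⬝ᵥ A *ᵥ w.ofLp = inner ℝ w (WithLp.toLp 2 (A *ᵥ w.ofLp)) := by
    simp [PiLp.inner_apply, dotProduct, mul_comm]
  rw [h1, ← hA.eigenvectorBasis.sum_inner_mul_inner]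
  refine Finset.sum_congr rfl fun i _ => ?_
  have h2 : inner ℝ (hA.eigenvectorBasis i) (WithLp.toLp 2 (A *ᵥ w.ofLp)) =
      hA.eigenvalues i * inner ℝ (hA.eigenvectorBasis i) w := by
    have e1 : inner ℝ (hA.eigenvectorBasis i) (WithLp.toLp 2 (A *ᵥ w.ofLp)) =
        (hA.eigenvectorBasis i).ofLp ⬝ᵥ A *ᵥ w.ofLp := by
      simp [PiLp.inner_apply, dotProduct, mul_comm]
    have e2 : inner ℝ (hA.eigenvectorBasis i) w = (hA.eigenvectorBasis i).ofLp ⬝ᵥ w.ofLp := by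
      simp [PiLp.inner_apply, dotProduct, mul_comm]
    rw [e1, e2, dotProduct_mulVec, ← mulVec_transpose]
    have : Aᵀ = A := by rw [← conjTranspose_eq_transpose_of_trivial]; exact hA
    rw [this, hA.mulVec_eigenvectorBasis, smul_dotProduct, smul_eq_mul]
  rw [h2, real_inner_comm]
  ring

theorem Matrix.IsHermitian.sum_dotProduct_mulVec_eigenvectorBasis (hB : B.IsHermitian)
    (D : Matrix ι ι ℝ) :
    ∑ j, (hB.eigenvectorBasis j).ofLp ⬝ᵥ D *ᵥ (hB.eigenvectorBasis j).ofLp = D.trace := by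
  have h : ((hB.eigenvectorUnitary : Matrix ι ι ℝ)ᴴ *
      (D * (hB.eigenvectorUnitary : Matrix ι ι ℝ))).trace = D.trace := by
    rw [Matrix.trace_mul_comm, Matrix.mul_assoc]
    have := (Matrix.mem_unitaryGroup_iff.mp hB.eigenvectorUnitary.2)
    rw [Matrix.star_eq_conjTranspose] at this
    rw [this, Matrix.mul_one]
  rw [← h]
  simp only [Matrix.trace, Matrix.diag_apply, Matrix.mul_apply, dotProduct, mulVec]
  rfl

omit [DecidableEq ι] in
theorem sum_sq_inner_left (b : OrthonormalBasis ι ℝ (EuclideanSpace ℝ ι))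
    (x : EuclideanSpace ℝ ι) : ∑ i, inner ℝ (b i) x ^ 2 = ‖x‖ ^ 2 := by
  rw [← real_inner_self_eq_norm_sq, ← b.sum_inner_mul_inner]
  refine Finset.sum_congr rfl fun i _ => ?_
  rw [real_inner_comm, sq]

theorem sqrt_le_tangent {a s : ℝ} (ha : 0 ≤ a) (hs : 0 < s) :
    √a ≤ s + (a - s ^ 2) / (2 * s) := by
  have h := sq_nonneg (√a - s)
  have h2 := Real.sq_sqrt ha
  rw [show s + (a - s ^ 2) / (2 * s) = (a + s ^ 2) / (2 * s) by field_simp; ring,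
    le_div_iff₀ (by positivity)]
  nlinarith

/-- The squared overlaps of the two eigenbases form a doubly stochastic matrix. Weighting with it
the tangent-line bounds for the square root turns the sum over eigenvalues of `A` into quadratic
forms of `A` in the eigenvectors of `B`. The shift by `t ^ 2` keeps the points of tangency away from
the possible eigenvalue `0` of `B`. -/
theorem sum_sqrt_eigenvalues_le (hA : A.PosSemidef) (hB : B.PosSemidef) {t : ℝ} (ht : 0 < t) :
    ∑ i, √(hA.1.eigenvalues i) ≤
      ∑ j, √(hB.1.eigenvalues j) + Fintype.card ι * t +
        ∑ j, ((hB.1.eigenvectorBasis j).ofLp ⬝ᵥ (A - B) *ᵥ (hB.1.eigenvectorBasis j).ofLp) /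
          (2 * √(hB.1.eigenvalues j + t ^ 2)) := by
  set u := hA.1.eigenvectorBasis with hu
  set w := hB.1.eigenvectorBasis with hw
  set α := hA.1.eigenvalues with hα
  set β := hB.1.eigenvalues with hβ
  have hβ0 : ∀ j, 0 ≤ β j := hB.eigenvalues_nonneg
  have hα0 : ∀ j, 0 ≤ α j := hA.eigenvalues_nonneg
  set s : ι → ℝ := fun j => √(β j + t ^ 2) with hs
  have hs0 : ∀ j, 0 < s j := fun j => Real.sqrt_pos.2 (by have := hβ0 j; positivity)
  have hs2 : ∀ j, s j ^ 2 = β j + t ^ 2 := fun j =>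
    Real.sq_sqrt (by have := hβ0 j; positivity)
  have hst : ∀ j, s j ≤ √(β j) + t := fun j => by
    refine Real.sqrt_le_iff.2 ⟨by positivity, ?_⟩
    nlinarith [Real.sq_sqrt (hβ0 j), Real.sqrt_nonneg (β j)]
  have hcol : ∀ j, ∑ i, inner ℝ (u i) (w j) ^ 2 = 1 := fun j => by
    rw [sum_sq_inner_left]; simp
  have hrow : ∀ i, ∑ j, inner ℝ (u i) (w j) ^ 2 = 1 := fun i => by
    simp_rw [real_inner_comm (w _) (u i)]
    rw [sum_sq_inner_left]; simp
  have hquadA : ∀ j, (w j).ofLp ⬝ᵥ A *ᵥ (w j).ofLp = ∑ i, α i * inner ℝ (u i) (w j) ^ 2 :=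
    fun j => hA.1.dotProduct_mulVec_eq_sum_eigenvalues (w j)
  have hquadB : ∀ j, (w j).ofLp ⬝ᵥ B *ᵥ (w j).ofLp = β j := fun j => by
    rw [hw, hB.1.mulVec_eigenvectorBasis, dotProduct_smul, smul_eq_mul]
    have : (hB.1.eigenvectorBasis j).ofLp ⬝ᵥ (hB.1.eigenvectorBasis j).ofLp = 1 := by
      have h := real_inner_self_eq_norm_sq (hB.1.eigenvectorBasis j)
      rw [OrthonormalBasis.norm_eq_one, one_pow, PiLp.inner_apply] at h
      exact h
    rw [this, mul_one]
  calc ∑ i, √(α i) = ∑ i, ∑ j, inner ℝ (u i) (w j) ^ 2 * √(α i) := by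
        refine Finset.sum_congr rfl fun i _ => ?_
        rw [← Finset.sum_mul, hrow, one_mul]
    _ ≤ ∑ i, ∑ j, inner ℝ (u i) (w j) ^ 2 * (s j + (α i - s j ^ 2) / (2 * s j)) := by
        gcongr with i _ j _
        exact sqrt_le_tangent (hα0 i) (hs0 j)
    _ = ∑ j, (s j + (∑ i, α i * inner ℝ (u i) (w j) ^ 2 - s j ^ 2) / (2 * s j)) := by
        rw [Finset.sum_comm]
        refine Finset.sum_congr rfl fun j _ => ?_
        have e : ∀ i, inner ℝ (u i) (w j) ^ 2 * (s j + (α i - s j ^ 2) / (2 * s j)) =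
            inner ℝ (u i) (w j) ^ 2 * (s j - s j ^ 2 / (2 * s j)) +
              α i * inner ℝ (u i) (w j) ^ 2 / (2 * s j) := fun i => by ring
        simp_rw [e]
        rw [Finset.sum_add_distrib, ← Finset.sum_mul, hcol, ← Finset.sum_div]
        ring
    _ ≤ ∑ j, (√(β j) + t + ((w j).ofLp ⬝ᵥ (A - B) *ᵥ (w j).ofLp) / (2 * s j)) := by
        gcongr with j _
        · exact hst j
        -- The quadratic form of `B` contributes `β j`, which is at most `s j ^ 2`; the surplus `t ^
        -- 2` is dropped.
        · rw [sub_mulVec, dotProduct_sub, hquadB, hquadA, hs2]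
          nlinarith [sq_nonneg t]
    _ = _ := by
        rw [Finset.sum_add_distrib, Finset.sum_add_distrib]
        simp [hs]

theorem sum_sqrt_eigenvalues_mono (hA : A.PosSemidef) (hB : B.PosSemidef)
    (hAB : (B - A).PosSemidef) :
    ∑ i, √(hA.1.eigenvalues i) ≤ ∑ i, √(hB.1.eigenvalues i) := by
  refine le_of_forall_pos_le_add fun ε hε => ?_
  have hN : (0 : ℝ) < Fintype.card ι + 1 := by positivity
  have ht : 0 < ε / (Fintype.card ι + 1) := by positivity
  refine (sum_sqrt_eigenvalues_le hA hB ht).trans ?_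
  have h1 : (Fintype.card ι : ℝ) * (ε / (Fintype.card ι + 1)) ≤ ε := by
    rw [← mul_div_assoc, div_le_iff₀ hN]; nlinarith
  have h2 : ∑ j, ((hB.1.eigenvectorBasis j).ofLp ⬝ᵥ (A - B) *ᵥ
      (hB.1.eigenvectorBasis j).ofLp) /
        (2 * √(hB.1.eigenvalues j + (ε / (Fintype.card ι + 1)) ^ 2)) ≤ 0 := by
    refine Finset.sum_nonpos fun j _ => div_nonpos_of_nonpos_of_nonneg ?_ (by positivity)
    have := hAB.dotProduct_mulVec_nonneg (hB.1.eigenvectorBasis j).ofLp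
    rw [← neg_sub B A, neg_mulVec, dotProduct_neg]
    simpa using this
  linarith

/-- Every shifted root is at least `t`, and the nonnegative quadratic forms of `B - A` in an
orthonormal basis add up to its trace. -/
theorem sum_sqrt_eigenvalues_le_add_trace (hA : A.PosSemidef) (hB : B.PosSemidef)
    (hAB : (B - A).PosSemidef) {t : ℝ} (ht : 0 < t) :
    ∑ i, √(hB.1.eigenvalues i) ≤
      ∑ i, √(hA.1.eigenvalues i) + Fintype.card ι * t + (B - A).trace / (2 * t) := by
  refine (sum_sqrt_eigenvalues_le hB hA ht).trans ?_
  gcongr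
  rw [← hA.1.sum_dotProduct_mulVec_eigenvectorBasis (B - A), Finset.sum_div]
  gcongr with j _
  · simpa using hAB.dotProduct_mulVec_nonneg (hA.1.eigenvectorBasis j).ofLp
  · refine Real.le_sqrt_of_sq_le ?_
    have := hA.eigenvalues_nonneg j
    linarith

theorem Matrix.IsHermitian.sum_sqrt_eigenvalues_eq_roots (hA : A.IsHermitian) :
    ∑ i, √(hA.eigenvalues i) = (A.charpoly.roots.map Real.sqrt).sum := by
  rw [hA.roots_charpoly_eq_eigenvalues, Multiset.map_map]
  rfl

end EigenvalueSums

/-! ### The invariant under disjoint unions and added edges -/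

section LaplacianEnergyLike

open Matrix

variable {V W : Type*} [Fintype V] [Fintype W]

/-- The omitted smallest eigenvalue contributes nothing: a Laplacian is singular, so some eigenvalue
vanishes, and the last one in decreasing order is at most that. -/
theorem LEL_eq_sum_sqrt_eigenvalues [DecidableEq V] (G : SimpleGraph V) [DecidableRel G.Adj] :
    LEL G = ∑ i, √((SimpleGraph.posSemidef_lapMatrix ℝ G).isHermitian.eigenvalues i) := by
  classical
  have key : LEL G = ∑ i, √((SimpleGraph.posSemidef_lapMatrix ℝ G).isHermitian.eigenvalues₀ i) := by
    unfold LEL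
    rw [Finset.sum_filter]
    convert! Finset.sum_congr rfl fun i _ => ?_ using 1
    split_ifs with h
    · congr!
    · symm
      rw [Real.sqrt_eq_zero']
      set hH := (SimpleGraph.posSemidef_lapMatrix ℝ G).isHermitian
      have hne : Nonempty V := Fintype.card_pos_iff.1 (by have := i.2; omega)
      have hdet := SimpleGraph.det_lapMatrix_eq_zero G
      rw [hH.det_eq_prod_eigenvalues, Finset.prod_eq_zero_iff] at hdet
      obtain ⟨v, -, hv⟩ := hdet
      have hv' : hH.eigenvalues₀ ((Fintype.equivOfCardEq (Fintype.card_fin _)).symm v) = 0 := by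
        simpa [Matrix.IsHermitian.eigenvalues] using hv
      rw [← hv']
      refine hH.eigenvalues₀_antitone ?_
      rw [Fin.le_def]
      have := ((Fintype.equivOfCardEq (Fintype.card_fin (Fintype.card V))).symm v).2
      omega
  rw [key]
  unfold Matrix.IsHermitian.eigenvalues
  exact (Equiv.sum_comp (Fintype.equivOfCardEq (Fintype.card_fin _)).symm
    fun i => √((SimpleGraph.posSemidef_lapMatrix ℝ G).isHermitian.eigenvalues₀ i)).symm

/-- This form does not mention an ordering of the eigenvalues, so relabelling, block matrices and
explicit factorisations can be handled through the characteristic polynomial. -/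
theorem LEL_eq_sum_roots [DecidableEq V] (G : SimpleGraph V) [DecidableRel G.Adj] :
    LEL G = ((G.lapMatrix ℝ).charpoly.roots.map Real.sqrt).sum := by
  rw [LEL_eq_sum_sqrt_eigenvalues, Matrix.IsHermitian.sum_sqrt_eigenvalues_eq_roots]

theorem LEL_congr (e : V ≃ W) (G : SimpleGraph W) : LEL (G.comap e) = LEL G := by
  classical
  rw [LEL_eq_sum_roots, LEL_eq_sum_roots, ← Matrix.charpoly_reindex e]
  congr 4
  ext i j
  have hdeg : (G.comap e).degree (e.symm i) = G.degree i := by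
    have := (SimpleGraph.Iso.comap e G).degree_eq (e.symm i)
    rw [← this]
    exact congrArg (fun w => G.degree w) (e.apply_symm_apply i)
  simp [SimpleGraph.lapMatrix, SimpleGraph.degMatrix, Matrix.diagonal_apply, hdeg,
    SimpleGraph.adjMatrix_apply]

theorem LEL_sum (G : SimpleGraph V) (H : SimpleGraph W) : LEL (G ⊕g H) = LEL G + LEL H := by
  classical
  have h : (G ⊕g H).lapMatrix ℝ = Matrix.fromBlocks (G.lapMatrix ℝ) 0 0 (H.lapMatrix ℝ) := by
    ext i j
    simp only [SimpleGraph.lapMatrix, SimpleGraph.degMatrix, Matrix.sub_apply,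
      Matrix.diagonal_apply, SimpleGraph.adjMatrix_apply, SimpleGraph.degree_eq_sum_if_adj]
    rcases i with i | i <;> rcases j with j | j <;>
      simp only [Fintype.sum_sum_type, SimpleGraph.sum_adj_inl, SimpleGraph.sum_adj_inr,
        SimpleGraph.not_adj_sum_inl_inr, SimpleGraph.adj_comm _ (Sum.inr _) (Sum.inl _)] <;>
      simp [Matrix.diagonal_apply]
  rw [LEL_eq_sum_roots, LEL_eq_sum_roots, LEL_eq_sum_roots, h,
    Matrix.charpoly_fromBlocks_zero₁₂, Polynomial.roots_mul, Multiset.map_add, Multiset.sum_add]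
  exact mul_ne_zero (Matrix.charpoly_monic _).ne_zero (Matrix.charpoly_monic _).ne_zero

theorem posSemidef_lapMatrix_sub [DecidableEq V] {G H : SimpleGraph V} [DecidableRel G.Adj]
    [DecidableRel H.Adj] (h : G ≤ H) : (H.lapMatrix ℝ - G.lapMatrix ℝ).PosSemidef := by
  refine .of_dotProduct_mulVec_nonneg
    ((H.isHermitian_lapMatrix ℝ).sub (G.isHermitian_lapMatrix ℝ)) fun x => ?_
  have e := fun (K : SimpleGraph V) [DecidableRel K.Adj] => K.lapMatrix_toLinearMap₂' ℝ x
  simp only [Matrix.toLinearMap₂'_apply'] at e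
  rw [star_trivial, sub_mulVec, dotProduct_sub, e H, e G, sub_nonneg]
  gcongr with i _ j _
  split_ifs with h1 h2 h2
  · exact le_rfl
  · exact absurd (h h1) h2
  · positivity
  · exact le_rfl

theorem LEL_mono {G H : SimpleGraph V} (h : G ≤ H) : LEL G ≤ LEL H := by
  classical
  rw [LEL_eq_sum_sqrt_eigenvalues, LEL_eq_sum_sqrt_eigenvalues]
  exact sum_sqrt_eigenvalues_mono (SimpleGraph.posSemidef_lapMatrix ℝ G)
    (SimpleGraph.posSemidef_lapMatrix ℝ H) (posSemidef_lapMatrix_sub h)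

theorem LEL_le_of_hom (e : V ≃ W) {G : SimpleGraph V} {H : SimpleGraph W}
    (h : ∀ u v, G.Adj u v → H.Adj (e u) (e v)) : LEL G ≤ LEL H := by
  rw [← LEL_congr e H]
  exact LEL_mono fun u v huv => h u v huv

theorem trace_lapMatrix [DecidableEq V] (G : SimpleGraph V) [DecidableRel G.Adj] :
    (G.lapMatrix ℝ).trace = ∑ v, (G.degree v : ℝ) := by
  simp [SimpleGraph.lapMatrix, SimpleGraph.degMatrix, Matrix.trace_sub, SimpleGraph.trace_adjMatrix,
    Matrix.trace_diagonal]

open scoped Classical in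
theorem sum_degree_fromRel_le (R : V → V → Prop) :
    ∑ v, ((SimpleGraph.fromRel R).degree v : ℝ) ≤
      2 * (Finset.univ.filter fun p : V × V => R p.1 p.2).card := by
  have h1 : ∀ v, ((SimpleGraph.fromRel R).degree v : ℝ) ≤
      ∑ w, ((if R v w then (1 : ℝ) else 0) + if R w v then 1 else 0) := by
    intro v
    rw [SimpleGraph.degree_eq_sum_if_adj]
    gcongr with w _
    simp only [SimpleGraph.fromRel_adj]
    split_ifs <;> simp_all
  calc _ ≤ ∑ v, ∑ w, ((if R v w then (1 : ℝ) else 0) + if R w v then 1 else 0) := by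
        gcongr with v _; exact h1 v
    _ = 2 * ∑ v, ∑ w, (if R v w then (1 : ℝ) else 0) := by
        simp_rw [Finset.sum_add_distrib]
        rw [Finset.sum_comm (f := fun v w => if R w v then (1 : ℝ) else 0)]
        ring
    _ = _ := by
        rw [← Finset.sum_product', Finset.univ_product_univ, Finset.sum_boole]

-- The trace of the Laplacian is the degree sum, to which every new bond adds at most `2`. The
-- parameter `t` is left free, to be balanced against the number of bonds.
open scoped Classical in
theorem LEL_sup_fromRel_le (G : SimpleGraph V) (R : V → V → Prop) {t c : ℝ} (ht : 0 < t)
    (hc : ((Finset.univ.filter fun p : V × V => R p.1 p.2).card : ℝ) ≤ c) :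
    LEL (G ⊔ SimpleGraph.fromRel R) ≤ LEL G + Fintype.card V * t + c / t := by
  rw [LEL_eq_sum_sqrt_eigenvalues, LEL_eq_sum_sqrt_eigenvalues]
  refine (sum_sqrt_eigenvalues_le_add_trace (SimpleGraph.posSemidef_lapMatrix ℝ G)
    (SimpleGraph.posSemidef_lapMatrix ℝ (G ⊔ SimpleGraph.fromRel R))
    (posSemidef_lapMatrix_sub le_sup_left) ht).trans ?_
  rw [show c / t = 2 * c / (2 * t) by field_simp]
  gcongr
  refine le_trans ?_ ((sum_degree_fromRel_le R).trans (by gcongr))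
  rw [Matrix.trace_sub, trace_lapMatrix, trace_lapMatrix, ← Finset.sum_sub_distrib]
  gcongr with v _
  rw [sub_le_iff_le_add, SimpleGraph.degree_eq_sum_if_adj, SimpleGraph.degree_eq_sum_if_adj,
    SimpleGraph.degree_eq_sum_if_adj, ← Finset.sum_add_distrib]
  gcongr with w _
  simp only [SimpleGraph.sup_adj]
  split_ifs <;> simp_all

end LaplacianEnergyLike

/-! ### Fekete's lemma and iterated limits -/

section SuperadditiveSequences

theorem exists_tendsto_div_of_superadditive {a : ℕ → ℝ} {C : ℝ}
    (hsup : ∀ k l, a k + a l ≤ a (k + l + 1)) (hC : ∀ k, a k ≤ C * ((k : ℝ) + 1)) :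
    ∃ L, Tendsto (fun n : ℕ => a n / ((n : ℝ) + 1)) atTop (𝓝 L) := by
  -- Index `k` stands for a strip of width `k + 1`; shifting by one, with value `0` at width `0`,
  -- gives a genuinely subadditive sequence.
  let u : ℕ → ℝ := fun N => Nat.casesOn N 0 fun k => -a k
  have hu : Subadditive u := by
    rintro (_ | k) (_ | l)
    · simp [u]
    · simp [u]
    · simp [u]
    · have := hsup k l
      rw [show k + 1 + (l + 1) = (k + l + 1) + 1 by ring]
      simp only [u]
      linarith
  have hb : BddBelow (Set.range fun n => u n / n) := by
    refine ⟨-max C 0, ?_⟩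
    rintro _ ⟨_ | k, rfl⟩
    · simp
    · simp only [u]
      rw [le_div_iff₀ (by positivity)]
      push_cast
      have h1 := hC k
      have h2 : C * ((k : ℝ) + 1) ≤ max C 0 * ((k : ℝ) + 1) := by gcongr; exact le_max_left _ _
      linarith
  refine ⟨-hu.lim, ?_⟩
  have h := ((hu.tendsto_lim hb).comp (tendsto_add_atTop_nat 1)).neg
  refine h.congr fun n => ?_
  simp [u, neg_div]

theorem HasIteratedLimit.of_tendsto {f : ℕ → ℕ → ℝ} {L : ℝ}
    (hf : Tendsto (fun p : ℕ × ℕ => f p.1 p.2) atTop (𝓝 L))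
    (hm : ∀ m, ∃ l, Tendsto (f m) atTop (𝓝 l)) : HasIteratedLimit f L := by
  choose g hg using hm
  refine ⟨g, hg, Metric.tendsto_atTop.2 fun ε hε => ?_⟩
  obtain ⟨⟨M, N⟩, h⟩ := Metric.tendsto_atTop.1 hf (ε / 2) (half_pos hε)
  refine ⟨M, fun m hm => ?_⟩
  have h1 : dist (g m) L ≤ ε / 2 := by
    refine le_of_tendsto ((hg m).dist tendsto_const_nhds) ?_
    filter_upwards [eventually_ge_atTop N] with n hn
    exact (h (m, n) ⟨hm, hn⟩).le
  linarith

theorem tendsto_const_div_sqrt_add_one (c : ℝ) :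
    Tendsto (fun n : ℕ => c / √((n : ℝ) + 1)) atTop (𝓝 0) :=
  tendsto_const_nhds.div_atTop
    (Real.tendsto_sqrt_atTop.comp (tendsto_natCast_atTop_atTop.atTop_add tendsto_const_nhds))

end SuperadditiveSequences

/-! ### Gluing strips and discarding boundary bonds -/

section Lattices

open scoped Classical in
theorem card_filter_le_of_param {V κ : Type*} [Fintype V] [Fintype κ] {R : V → V → Prop}
    (f : κ → V × V) (h : ∀ u v, R u v → ∃ k, f k = (u, v)) :
    (Finset.univ.filter fun p : V × V => R p.1 p.2).card ≤ Fintype.card κ := by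
  refine (Finset.card_le_card (t := Finset.univ.image f) fun p hp => ?_).trans
    Finset.card_image_le
  obtain ⟨k, hk⟩ := h p.1 p.2 (Finset.mem_filter.1 hp).2
  exact Finset.mem_image.2 ⟨k, Finset.mem_univ _, hk⟩

open scoped Classical in
theorem card_hexRowClosing_le (m n : ℕ) :
    (Finset.univ.filter fun p : HexVertex m n × HexVertex m n =>
      hexRowClosing m n p.1 p.2).card ≤ m + 1 := by
  refine (card_filter_le_of_param
    (fun i : Fin (m + 1) => ((i, 0, false), (i, Fin.last n, true))) ?_).trans_eq
      (Fintype.card_fin _)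
  rintro ⟨i, j, _ | _⟩ ⟨i', j', _ | _⟩ h <;> simp [hexRowClosing] at h ⊢
  exact ⟨h.2.1.symm, h.1, h.2.2.symm⟩

open scoped Classical in
theorem card_hexColClosing_le (m n : ℕ) :
    (Finset.univ.filter fun p : HexVertex m n × HexVertex m n =>
      hexColClosing m n p.1 p.2).card ≤ n + 1 := by
  refine (card_filter_le_of_param
    (fun j : Fin (n + 1) => ((0, j, false), (Fin.last m, j, true))) ?_).trans_eq
      (Fintype.card_fin _)
  rintro ⟨i, j, _ | _⟩ ⟨i', j', _ | _⟩ h <;> simp [hexColClosing] at h ⊢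
  grind

open scoped Classical in
theorem card_hexBond_le (m n : ℕ) :
    (Finset.univ.filter fun p : HexVertex m n × HexVertex m n =>
      hexBond m n p.1 p.2).card ≤ 3 * ((m + 1) * (n + 1)) := by
  refine (card_filter_le_of_param
    (fun k : Fin 3 × Fin (m + 1) × Fin (n + 1) => ((k.2.1, k.2.2, false),
      (![k.2.1, k.2.1, k.2.1 - 1] k.1, ![k.2.2, k.2.2 - 1, k.2.2] k.1, true))) ?_).trans_eq
      (by simp)
  have key : ∀ {N : ℕ} (a b : Fin (N + 1)), (a : ℕ) = b + 1 → a - 1 = b := by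
    intro N a b h
    rw [sub_eq_iff_eq_add]
    ext
    rw [Fin.val_add_one_of_lt (by rw [Fin.lt_def, Fin.val_last]; omega), h]
  rintro ⟨i, j, _ | _⟩ ⟨i', j', _ | _⟩ h <;> simp [hexBond] at h ⊢
  obtain h | h | h := h
  · exact ⟨0, by simp [h]⟩
  · exact ⟨1, by simp [h, key _ _ h.2]⟩
  · exact ⟨2, by simp [h, key _ _ h.1]⟩

theorem LEL_bot (V : Type*) [Fintype V] : LEL (⊥ : SimpleGraph V) = 0 := by
  classical
  have h : (⊥ : SimpleGraph V).lapMatrix ℝ = 0 := by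
    ext i j
    simp only [SimpleGraph.lapMatrix, SimpleGraph.degMatrix, Matrix.sub_apply,
      Matrix.diagonal_apply, SimpleGraph.adjMatrix_apply, SimpleGraph.degree_eq_sum_if_adj]
    simp
  rw [LEL_eq_sum_roots, h, Matrix.charpoly_zero, Polynomial.roots_X_pow]
  rw [Multiset.nsmul_singleton, Multiset.map_replicate, Multiset.sum_replicate, Real.sqrt_zero,
    smul_zero]

/-- The hexagonal lattice that is closed to a cycle in the `m`-direction only. -/
def hexColCylinder (m n : ℕ) : SimpleGraph (HexVertex m n) :=
  hexFree m n ⊔ SimpleGraph.fromRel (hexColClosing m n)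

/-- For fixed `m` the bonds in `hexColClosing` are a fixed proportion of the lattice and cannot be
discarded as `n → ∞`. The inner limit for the torus is therefore obtained by keeping them and
discarding the row closings instead. -/
theorem hexTorus_eq (m n : ℕ) :
    hexTorus m n = hexColCylinder m n ⊔ SimpleGraph.fromRel (hexRowClosing m n) :=
  sup_right_comm _ _ _

theorem card_hexVertex (m n : ℕ) :
    (Fintype.card (HexVertex m n) : ℝ) = 2 * ((m : ℝ) + 1) * ((n : ℝ) + 1) := by
  simp [HexVertex]; ring

theorem LEL_hexFree_le (m n : ℕ) :
    LEL (hexFree m n) ≤ 5 * ((m : ℝ) + 1) * ((n : ℝ) + 1) := by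
  have h := LEL_sup_fromRel_le ⊥ (hexBond m n) one_pos
    (c := 3 * ((m : ℝ) + 1) * ((n : ℝ) + 1))
    (by exact_mod_cast (card_hexBond_le m n).trans_eq (by ring))
  rw [bot_sup_eq, LEL_bot, card_hexVertex] at h
  unfold hexFree
  linarith

theorem LEL_hexColCylinder_le (m n : ℕ) :
    LEL (hexColCylinder m n) ≤ (7 * ((m : ℝ) + 1) + 1) * ((n : ℝ) + 1) := by
  have h := LEL_sup_fromRel_le (hexFree m n) (hexColClosing m n) one_pos
    (c := (n : ℝ) + 1) (by exact_mod_cast card_hexColClosing_le m n)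
  rw [card_hexVertex] at h
  have := LEL_hexFree_le m n
  unfold hexColCylinder
  linarith

/-- Gluing two strips of widths `a + 1` and `b + 1` along their short sides. -/
def hexGlue (m a b : ℕ) : HexVertex m a ⊕ HexVertex m b → HexVertex m (a + b + 1) :=
  Sum.elim (fun v => (v.1, ⟨v.2.1, by omega⟩, v.2.2))
    (fun v => (v.1, ⟨a + 1 + v.2.1, by omega⟩, v.2.2))

theorem hexGlue_bijective (m a b : ℕ) : Function.Bijective (hexGlue m a b) := by
  rw [Fintype.bijective_iff_injective_and_card]
  refine ⟨?_, ?_⟩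
  · rintro (⟨i, j, s⟩ | ⟨i, j, s⟩) (⟨i', j', s'⟩ | ⟨i', j', s'⟩) h <;>
      simp [hexGlue, Fin.ext_iff] at h ⊢ <;> first | tauto | omega
  · simp [HexVertex]; ring

theorem hexBond_hexGlue_inl {m a : ℕ} (b : ℕ) {u v : HexVertex m a} (h : hexBond m a u v) :
    hexBond m (a + b + 1) (hexGlue m a b (.inl u)) (hexGlue m a b (.inl v)) := by
  obtain ⟨i, j, _ | _⟩ := u <;> obtain ⟨i', j', _ | _⟩ := v <;>
    simp only [hexBond, hexGlue, Sum.elim_inl, Fin.ext_iff] at h ⊢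
  exact h

theorem hexBond_hexGlue_inr {m b : ℕ} (a : ℕ) {u v : HexVertex m b} (h : hexBond m b u v) :
    hexBond m (a + b + 1) (hexGlue m a b (.inr u)) (hexGlue m a b (.inr v)) := by
  obtain ⟨i, j, _ | _⟩ := u <;> obtain ⟨i', j', _ | _⟩ := v <;>
    simp only [hexBond, hexGlue, Sum.elim_inr, Fin.ext_iff] at h ⊢
  omega

theorem hexColClosing_hexGlue_inl {m a : ℕ} (b : ℕ) {u v : HexVertex m a}
    (h : hexColClosing m a u v) :
    hexColClosing m (a + b + 1) (hexGlue m a b (.inl u)) (hexGlue m a b (.inl v)) := by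
  obtain ⟨i, j, _ | _⟩ := u <;> obtain ⟨i', j', _ | _⟩ := v <;>
    simp only [hexColClosing, hexGlue, Sum.elim_inl] at h ⊢
  exact ⟨by rw [h.1], h.2⟩

theorem hexColClosing_hexGlue_inr {m b : ℕ} (a : ℕ) {u v : HexVertex m b}
    (h : hexColClosing m b u v) :
    hexColClosing m (a + b + 1) (hexGlue m a b (.inr u)) (hexGlue m a b (.inr v)) := by
  obtain ⟨i, j, _ | _⟩ := u <;> obtain ⟨i', j', _ | _⟩ := v <;>
    simp only [hexColClosing, hexGlue, Sum.elim_inr] at h ⊢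
  exact ⟨by rw [h.1], h.2⟩

theorem fromRel_adj_of_map {V W : Type*} {R : V → V → Prop} {S : W → W → Prop} {f : V → W}
    (hf : f.Injective) (h : ∀ {u v}, R u v → S (f u) (f v)) {u v : V}
    (huv : (SimpleGraph.fromRel R).Adj u v) : (SimpleGraph.fromRel S).Adj (f u) (f v) :=
  ⟨hf.ne huv.1, huv.2.imp h h⟩

/-- The disjoint union of two strips is a spanning subgraph of the glued strip, which only lacks the
bonds across the seam. The closing bonds in the `m`-direction stay within one strip, so the same
works for `hexColCylinder`, but not for the row closings. -/
theorem LEL_hexFree_superadditive (m a b : ℕ) :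
    LEL (hexFree m a) + LEL (hexFree m b) ≤ LEL (hexFree m (a + b + 1)) := by
  have hi := (hexGlue_bijective m a b).injective
  rw [← LEL_sum]
  refine LEL_le_of_hom (Equiv.ofBijective _ (hexGlue_bijective m a b)) ?_
  rintro (u | u) (v | v) h
  · exact fromRel_adj_of_map (hi.comp Sum.inl_injective) (hexBond_hexGlue_inl b) h
  · exact (SimpleGraph.not_adj_sum_inl_inr _ _ h).elim
  · exact (SimpleGraph.not_adj_sum_inl_inr _ _ h.symm).elim
  · exact fromRel_adj_of_map (hi.comp Sum.inr_injective) (hexBond_hexGlue_inr a) h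

theorem LEL_hexColCylinder_superadditive (m a b : ℕ) :
    LEL (hexColCylinder m a) + LEL (hexColCylinder m b) ≤
      LEL (hexColCylinder m (a + b + 1)) := by
  have hi := (hexGlue_bijective m a b).injective
  rw [← LEL_sum]
  refine LEL_le_of_hom (Equiv.ofBijective _ (hexGlue_bijective m a b)) ?_
  rintro (u | u) (v | v) h
  · exact Or.imp (fromRel_adj_of_map (hi.comp Sum.inl_injective) (hexBond_hexGlue_inl b))
      (fromRel_adj_of_map (hi.comp Sum.inl_injective) (hexColClosing_hexGlue_inl b)) h
  · exact (SimpleGraph.not_adj_sum_inl_inr _ _ h).elim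
  · exact (SimpleGraph.not_adj_sum_inl_inr _ _ h.symm).elim
  · exact Or.imp (fromRel_adj_of_map (hi.comp Sum.inr_injective) (hexBond_hexGlue_inr a))
      (fromRel_adj_of_map (hi.comp Sum.inr_injective) (hexColClosing_hexGlue_inr a)) h

theorem normalized_LEL_sup_fromRel_le {m n : ℕ} (G : SimpleGraph (HexVertex m n))
    (R : HexVertex m n → HexVertex m n → Prop) {c x : ℝ} (hx : 0 < x)
    (hcx : c * x = ((m : ℝ) + 1) * ((n : ℝ) + 1))
    (hc : (open scoped Classical in
      ((Finset.univ.filter fun p : HexVertex m n × HexVertex m n => R p.1 p.2).card : ℝ)) ≤ c) :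
    LEL (G ⊔ SimpleGraph.fromRel R) / (2 * ((m : ℝ) + 1) * ((n : ℝ) + 1)) ≤
      LEL G / (2 * ((m : ℝ) + 1) * ((n : ℝ) + 1)) + (3 / 2) / √x := by
  have hs : 0 < √x := Real.sqrt_pos.2 hx
  -- With `c * x` equal to half the number of vertices, this `t` makes both error terms multiples of
  -- `(m + 1) (n + 1) / √x`, with factors `2` and `1`.
  have h := LEL_sup_fromRel_le G R (t := 1 / √x) (by positivity) hc
  rw [card_hexVertex] at h
  have hpos : (0 : ℝ) < 2 * ((m : ℝ) + 1) * ((n : ℝ) + 1) := by positivity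
  rw [div_add' _ _ _ hpos.ne', div_le_div_iff_of_pos_right hpos]
  have h2 : c / (1 / √x) = ((m : ℝ) + 1) * ((n : ℝ) + 1) / √x := by
    rw [← hcx]
    field_simp
    rw [Real.sq_sqrt hx.le]
  rw [h2] at h
  refine h.trans_eq ?_
  ring

theorem LEL_hexFree_le_hexCylinder (m n : ℕ) : LEL (hexFree m n) ≤ LEL (hexCylinder m n) :=
  LEL_mono le_sup_left

theorem LEL_hexCylinder_le_hexTorus (m n : ℕ) : LEL (hexCylinder m n) ≤ LEL (hexTorus m n) :=
  LEL_mono le_sup_left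

theorem LEL_hexColCylinder_le_hexTorus (m n : ℕ) :
    LEL (hexColCylinder m n) ≤ LEL (hexTorus m n) := by
  rw [hexTorus_eq]
  exact LEL_mono le_sup_left

theorem normalized_LEL_hexCylinder_le (m n : ℕ) :
    LEL (hexCylinder m n) / (2 * ((m : ℝ) + 1) * ((n : ℝ) + 1)) ≤
      LEL (hexFree m n) / (2 * ((m : ℝ) + 1) * ((n : ℝ) + 1)) + (3 / 2) / √((n : ℝ) + 1) :=
  normalized_LEL_sup_fromRel_le _ _ (c := (m : ℝ) + 1) (by positivity) rfl
    (by exact_mod_cast card_hexRowClosing_le m n)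

theorem normalized_LEL_hexTorus_le_hexCylinder (m n : ℕ) :
    LEL (hexTorus m n) / (2 * ((m : ℝ) + 1) * ((n : ℝ) + 1)) ≤
      LEL (hexCylinder m n) / (2 * ((m : ℝ) + 1) * ((n : ℝ) + 1)) + (3 / 2) / √((m : ℝ) + 1) :=
  normalized_LEL_sup_fromRel_le _ _ (c := (n : ℝ) + 1) (by positivity) (mul_comm _ _)
    (by exact_mod_cast card_hexColClosing_le m n)

theorem normalized_LEL_hexTorus_le_hexColCylinder (m n : ℕ) :
    LEL (hexTorus m n) / (2 * ((m : ℝ) + 1) * ((n : ℝ) + 1)) ≤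
      LEL (hexColCylinder m n) / (2 * ((m : ℝ) + 1) * ((n : ℝ) + 1)) +
        (3 / 2) / √((n : ℝ) + 1) := by
  rw [hexTorus_eq]
  exact normalized_LEL_sup_fromRel_le _ _ (c := (m : ℝ) + 1) (by positivity) rfl
    (by exact_mod_cast card_hexRowClosing_le m n)

theorem exists_tendsto_normalized_hexFree (m : ℕ) :
    ∃ l, Tendsto (fun n : ℕ => LEL (hexFree m n) / (2 * ((m : ℝ) + 1) * ((n : ℝ) + 1)))
      atTop (𝓝 l) := by
  obtain ⟨L, hL⟩ := exists_tendsto_div_of_superadditive (LEL_hexFree_superadditive m)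
    (LEL_hexFree_le m)
  refine ⟨L / (2 * ((m : ℝ) + 1)), (hL.div_const _).congr fun n => ?_⟩
  rw [div_div, mul_comm ((n : ℝ) + 1)]

theorem exists_tendsto_normalized_hexColCylinder (m : ℕ) :
    ∃ l, Tendsto (fun n : ℕ => LEL (hexColCylinder m n) / (2 * ((m : ℝ) + 1) * ((n : ℝ) + 1)))
      atTop (𝓝 l) := by
  obtain ⟨L, hL⟩ := exists_tendsto_div_of_superadditive (LEL_hexColCylinder_superadditive m)
    (LEL_hexColCylinder_le m)
  refine ⟨L / (2 * ((m : ℝ) + 1)), (hL.div_const _).congr fun n => ?_⟩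
  rw [div_div, mul_comm ((n : ℝ) + 1)]

theorem exists_tendsto_normalized_hexCylinder (m : ℕ) :
    ∃ l, Tendsto (fun n : ℕ => LEL (hexCylinder m n) / (2 * ((m : ℝ) + 1) * ((n : ℝ) + 1)))
      atTop (𝓝 l) := by
  obtain ⟨l, hl⟩ := exists_tendsto_normalized_hexFree m
  refine ⟨l, tendsto_of_tendsto_of_tendsto_of_le_of_le hl
    (by simpa using hl.add (tendsto_const_div_sqrt_add_one (3 / 2))) (fun n => ?_)
    fun n => normalized_LEL_hexCylinder_le m n⟩
  exact div_le_div_of_nonneg_right (LEL_hexFree_le_hexCylinder m n) (by positivity)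

theorem exists_tendsto_normalized_hexTorus (m : ℕ) :
    ∃ l, Tendsto (fun n : ℕ => LEL (hexTorus m n) / (2 * ((m : ℝ) + 1) * ((n : ℝ) + 1)))
      atTop (𝓝 l) := by
  obtain ⟨l, hl⟩ := exists_tendsto_normalized_hexColCylinder m
  refine ⟨l, tendsto_of_tendsto_of_tendsto_of_le_of_le hl
    (by simpa using hl.add (tendsto_const_div_sqrt_add_one (3 / 2))) (fun n => ?_)
    fun n => normalized_LEL_hexTorus_le_hexColCylinder m n⟩
  exact div_le_div_of_nonneg_right (LEL_hexColCylinder_le_hexTorus m n) (by positivity)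

theorem tendsto_normalized_hexCylinder {L : ℝ}
    (h : Tendsto (fun p : ℕ × ℕ => LEL (hexTorus p.1 p.2) /
      (2 * ((p.1 : ℝ) + 1) * ((p.2 : ℝ) + 1))) atTop (𝓝 L)) :
    Tendsto (fun p : ℕ × ℕ => LEL (hexCylinder p.1 p.2) /
      (2 * ((p.1 : ℝ) + 1) * ((p.2 : ℝ) + 1))) atTop (𝓝 L) := by
  have h0 := (tendsto_const_div_sqrt_add_one (3 / 2)).comp
    (show Tendsto (Prod.fst : ℕ × ℕ → ℕ) atTop atTop from
      prod_atTop_atTop_eq (α := ℕ) (β := ℕ) ▸ tendsto_fst)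
  refine tendsto_of_tendsto_of_tendsto_of_le_of_le (by simpa using h.sub h0) h (fun p => ?_)
    fun p => ?_
  · have := normalized_LEL_hexTorus_le_hexCylinder p.1 p.2
    linarith
  · exact div_le_div_of_nonneg_right (LEL_hexCylinder_le_hexTorus p.1 p.2) (by positivity)

theorem tendsto_normalized_hexFree {L : ℝ}
    (h : Tendsto (fun p : ℕ × ℕ => LEL (hexCylinder p.1 p.2) /
      (2 * ((p.1 : ℝ) + 1) * ((p.2 : ℝ) + 1))) atTop (𝓝 L)) :
    Tendsto (fun p : ℕ × ℕ => LEL (hexFree p.1 p.2) /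
      (2 * ((p.1 : ℝ) + 1) * ((p.2 : ℝ) + 1))) atTop (𝓝 L) := by
  have h0 := (tendsto_const_div_sqrt_add_one (3 / 2)).comp
    (show Tendsto (Prod.snd : ℕ × ℕ → ℕ) atTop atTop from
      prod_atTop_atTop_eq (α := ℕ) (β := ℕ) ▸ tendsto_snd)
  refine tendsto_of_tendsto_of_tendsto_of_le_of_le (by simpa using h.sub h0) h (fun p => ?_)
    fun p => ?_
  · have := normalized_LEL_hexCylinder_le p.1 p.2
    linarith
  · exact div_le_div_of_nonneg_right (LEL_hexFree_le_hexCylinder p.1 p.2) (by positivity)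

theorem isEquivalent_of_tendsto_normalized {f : ℕ × ℕ → ℝ} {L : ℝ} (hL : L ≠ 0)
    (h : Tendsto (fun p : ℕ × ℕ => f p / (2 * ((p.1 : ℝ) + 1) * ((p.2 : ℝ) + 1))) atTop (𝓝 L)) :
    f ~[atTop] fun p : ℕ × ℕ => 2 * L * ((p.1 : ℝ) + 1) * ((p.2 : ℝ) + 1) := by
  refine (isEquivalent_iff_tendsto_one (Eventually.of_forall fun p => by positivity)).2 ?_
  have := h.div_const L
  rw [div_self hL] at this
  refine this.congr fun p => ?_
  simp only [Pi.div_apply]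
  rw [div_div]
  congr 1
  ring

end Lattices

/-! ### Fourier diagonalisation of the toroidal Laplacian -/

section TorusSpectrum

open Matrix Polynomial

/-- The closing bonds are exactly the wrap-around cases of addition in `Fin`, so adjacency becomes
invariant under cyclic shifts. -/
theorem hexTorus_adj_iff {m n : ℕ} {i i' : Fin (m + 1)} {j j' : Fin (n + 1)} :
    (hexTorus m n).Adj (i, j, false) (i', j', true) ↔
      (i = i' ∧ j = j') ∨ (i = i' ∧ j = j' + 1) ∨ (i = i' + 1 ∧ j = j') := by
  have key : ∀ {N : ℕ} (a b : Fin (N + 1)),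
      a = b + 1 ↔ (a : ℕ) = b + 1 ∨ (a = 0 ∧ b = Fin.last N) := by
    intro N a b
    rw [Fin.ext_iff, Fin.val_add_one, Fin.ext_iff (b := 0), Fin.val_zero]
    have := a.2
    split_ifs with h
    · rw [h, Fin.val_last]; omega
    · simp [h]
  simp only [hexTorus, hexCylinder, hexFree, SimpleGraph.sup_adj, SimpleGraph.fromRel_adj,
    hexBond, hexRowClosing, hexColClosing, key]
  simp
  tauto

theorem not_hexTorus_adj {m n : ℕ} {i i' : Fin (m + 1)} {j j' : Fin (n + 1)} {s : Bool} :
    ¬(hexTorus m n).Adj (i, j, s) (i', j', s) := by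
  cases s <;> simp [hexTorus, hexCylinder, hexFree, hexBond, hexRowClosing, hexColClosing]

open scoped Classical in
theorem neighborFinset_hexTorus_true (m n : ℕ) (i : Fin (m + 1)) (j : Fin (n + 1)) :
    (hexTorus m n).neighborFinset (i, j, true) =
      {(i, j, false), (i, j + 1, false), (i + 1, j, false)} := by
  ext ⟨i', j', _ | _⟩
  · rw [SimpleGraph.mem_neighborFinset, SimpleGraph.adj_comm, hexTorus_adj_iff]
    simp
  · simp [SimpleGraph.mem_neighborFinset, not_hexTorus_adj]

open scoped Classical in
theorem neighborFinset_hexTorus_false (m n : ℕ) (i : Fin (m + 1)) (j : Fin (n + 1)) :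
    (hexTorus m n).neighborFinset (i, j, false) =
      {(i, j, true), (i, j - 1, true), (i - 1, j, true)} := by
  ext ⟨i', j', _ | _⟩
  · simp [SimpleGraph.mem_neighborFinset, not_hexTorus_adj]
  · rw [SimpleGraph.mem_neighborFinset, hexTorus_adj_iff]
    simp [eq_sub_iff_add_eq, eq_comm]

open scoped Classical in
-- Excluding `m = 0` and `n = 0` makes `1 ≠ 0` in both index groups, so the three neighbours are
-- distinct and the degree is `3`.
theorem lapMatrix_hexTorus_mulVec_true {m n : ℕ} (hm : m ≠ 0) (hn : n ≠ 0)
    (f : HexVertex m n → ℂ) (i : Fin (m + 1)) (j : Fin (n + 1)) :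
    ((hexTorus m n).lapMatrix ℂ *ᵥ f) (i, j, true) =
      3 * f (i, j, true) - (f (i, j, false) + f (i, j + 1, false) + f (i + 1, j, false)) := by
  have h1 : (1 : Fin (m + 1)) ≠ 0 := by simpa using hm
  have h2 : (1 : Fin (n + 1)) ≠ 0 := by simpa using hn
  rw [SimpleGraph.lapMatrix_mulVec_apply, ← SimpleGraph.card_neighborFinset_eq_degree,
    neighborFinset_hexTorus_true, Finset.sum_insert, Finset.sum_insert, Finset.sum_singleton,
    Finset.card_insert_of_notMem, Finset.card_insert_of_notMem, Finset.card_singleton]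
  · push_cast
    ring
  all_goals simp [h1, h2]

open scoped Classical in
theorem lapMatrix_hexTorus_mulVec_false {m n : ℕ} (hm : m ≠ 0) (hn : n ≠ 0)
    (f : HexVertex m n → ℂ) (i : Fin (m + 1)) (j : Fin (n + 1)) :
    ((hexTorus m n).lapMatrix ℂ *ᵥ f) (i, j, false) =
      3 * f (i, j, false) - (f (i, j, true) + f (i, j - 1, true) + f (i - 1, j, true)) := by
  have h1 : (1 : Fin (m + 1)) ≠ 0 := by simpa using hm
  have h2 : (1 : Fin (n + 1)) ≠ 0 := by simpa using hn
  rw [SimpleGraph.lapMatrix_mulVec_apply, ← SimpleGraph.card_neighborFinset_eq_degree,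
    neighborFinset_hexTorus_false, Finset.sum_insert, Finset.sum_insert, Finset.sum_singleton,
    Finset.card_insert_of_notMem, Finset.card_insert_of_notMem, Finset.card_singleton]
  · push_cast
    ring
  all_goals simp [h1, h2, eq_sub_iff_add_eq]

theorem pow_val_add_one {N : ℕ} {z : ℂ} (hz : z ^ (N + 1) = 1) (i : Fin (N + 1)) :
    z ^ ((i + 1 : Fin (N + 1)) : ℕ) = z ^ (i : ℕ) * z := by
  rw [Fin.val_add_one, ← pow_succ]
  split_ifs with h
  · rw [h, Fin.val_last, hz, pow_zero]
  · rfl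

theorem pow_val_sub_one {N : ℕ} {z : ℂ} (hz : z ^ (N + 1) = 1) (i : Fin (N + 1)) :
    z ^ ((i - 1 : Fin (N + 1)) : ℕ) = z ^ (i : ℕ) * z⁻¹ := by
  have h0 : z ≠ 0 := by rintro rfl; simp at hz
  rw [eq_mul_inv_iff_mul_eq₀ h0, ← pow_val_add_one hz, sub_add_cancel]

/-- The symbol of the Laplacian of the toroidal lattice at the pair of phases `z, w`. -/
noncomputable def hexSymbol (z w : ℂ) : Matrix Bool Bool ℂ :=
  fun s t => bif s then (bif t then 3 else -(1 + z + w)) else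
    (bif t then -(1 + z⁻¹ + w⁻¹) else 3)

theorem charpoly_hexSymbol (z w : ℂ) :
    (hexSymbol z w).charpoly = (X - C 3) ^ 2 - C ((1 + z + w) * (1 + z⁻¹ + w⁻¹)) := by
  have e : (hexSymbol z w).charpoly = (reindex finTwoEquiv.symm finTwoEquiv.symm
      (hexSymbol z w)).charpoly := (charpoly_reindex _ _).symm
  rw [e, Matrix.charpoly, det_fin_two]
  simp [hexSymbol, finTwoEquiv]
  ring

/-- The Fourier matrix with nodes `ζ ^ a` for a root of unity `ζ`. -/
noncomputable def fourierMatrix (N : ℕ) (ζ : ℂ) : Matrix (Fin N) (Fin N) ℂ :=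
  (vandermonde fun a : Fin N => ζ ^ (a : ℕ))ᵀ

theorem isUnit_det_fourierMatrix {N : ℕ} {ζ : ℂ} (h : IsPrimitiveRoot ζ N) :
    IsUnit (fourierMatrix N ζ).det := by
  rw [fourierMatrix, det_transpose, isUnit_iff_ne_zero, det_vandermonde_ne_zero_iff]
  intro a b hab
  exact Fin.ext (h.pow_inj a.2 b.2 hab)

-- Plane waves on the two sublattices span invariant planes: the Fourier matrix `U` intertwines the
-- Laplacian with the block diagonal matrix of symbols, and `U` is invertible as a Kronecker product
-- of Vandermonde matrices with distinct nodes and an identity.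
open scoped Classical in
theorem charpoly_lapMatrix_hexTorus {m n : ℕ} (hm : m ≠ 0) (hn : n ≠ 0) {ζ ξ : ℂ}
    (hζ : IsPrimitiveRoot ζ (m + 1)) (hξ : IsPrimitiveRoot ξ (n + 1)) :
    ((hexTorus m n).lapMatrix ℂ).charpoly = ∏ k : Fin (m + 1) × Fin (n + 1),
      (hexSymbol (ζ ^ (k.1 : ℕ)) (ξ ^ (k.2 : ℕ))).charpoly := by
  let B : Fin (m + 1) × Fin (n + 1) → Matrix Bool Bool ℂ := fun k =>
    hexSymbol (ζ ^ (k.1 : ℕ)) (ξ ^ (k.2 : ℕ))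
  let e : Bool × (Fin (m + 1) × Fin (n + 1)) ≃ HexVertex m n :=
    (Equiv.prodComm _ _).trans (Equiv.prodAssoc _ _ _)
  let D : Matrix (HexVertex m n) (HexVertex m n) ℂ := reindex e e (blockDiagonal B)
  let U : Matrix (HexVertex m n) (HexVertex m n) ℂ :=
    kroneckerMap (· * ·) (fourierMatrix (m + 1) ζ)
      (kroneckerMap (· * ·) (fourierMatrix (n + 1) ξ) (1 : Matrix Bool Bool ℂ))
  have hU : IsUnit U.det := by
    rw [det_kronecker, det_kronecker, det_one, one_pow, mul_one]
    exact ((isUnit_det_fourierMatrix hζ).pow _).mul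
      ((((isUnit_det_fourierMatrix hξ).pow _)).pow _)
  have hLU : (hexTorus m n).lapMatrix ℂ * U = U * D := by
    ext ⟨i, j, s⟩ ⟨a, b, t⟩
    have hz : (ζ ^ (a : ℕ)) ^ (m + 1) = 1 := by
      rw [← pow_mul, mul_comm, pow_mul, hζ.pow_eq_one, one_pow]
    have hw : (ξ ^ (b : ℕ)) ^ (n + 1) = 1 := by
      rw [← pow_mul, mul_comm, pow_mul, hξ.pow_eq_one, one_pow]
    have hR : (U * D) (i, j, s) (a, b, t) =
        (ζ ^ (a : ℕ)) ^ (i : ℕ) * (ξ ^ (b : ℕ)) ^ (j : ℕ) *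
          hexSymbol (ζ ^ (a : ℕ)) (ξ ^ (b : ℕ)) s t := by
      rw [mul_apply, Fintype.sum_eq_single (a, b, s)]
      · simp [U, D, e, B, fourierMatrix, blockDiagonal_apply]
      · rintro ⟨a', b', s'⟩ h
        by_cases hs : s = s'
        · subst hs
          have : (a', b') ≠ (a, b) := by rintro h'; simp_all
          simp [D, e, blockDiagonal_apply, this]
        · simp [U, one_apply, hs]
    rw [hR]
    have hL : ((hexTorus m n).lapMatrix ℂ * U) (i, j, s) (a, b, t) =
        ((hexTorus m n).lapMatrix ℂ *ᵥ fun v => U v (a, b, t)) (i, j, s) := rfl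
    rw [hL]
    cases s
    · rw [lapMatrix_hexTorus_mulVec_false hm hn]
      cases t <;> simp [U, fourierMatrix, hexSymbol, pow_val_sub_one hz, pow_val_sub_one hw] <;>
        ring
    · rw [lapMatrix_hexTorus_mulVec_true hm hn]
      cases t <;> simp [U, fourierMatrix, hexSymbol, pow_val_add_one hz, pow_val_add_one hw] <;>
        ring
  have hsim : (hexTorus m n).lapMatrix ℂ = U * D * U⁻¹ := by
    rw [← hLU, mul_nonsing_inv_cancel_right _ _ hU]
  rw [hsim, Matrix.charpoly_mul_comm, nonsing_inv_mul_cancel_left _ _ hU, charpoly_reindex]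
  have hc : (blockDiagonal B).charmatrix = blockDiagonal fun k => (B k).charmatrix := by
    ext ⟨s, k⟩ ⟨t, l⟩
    by_cases h : k = l
    · subst h
      simp [charmatrix_apply, blockDiagonal_apply, diagonal_apply]
    · simp [blockDiagonal_apply, h]
  rw [Matrix.charpoly, hc, det_blockDiagonal]
  rfl

/-- The squared modulus of `1 + exp (ix) + exp (-iy)`. -/
noncomputable def hexDispersion (x y : ℝ) : ℝ :=
  3 + 2 * Real.cos x + 2 * Real.cos y + 2 * Real.cos (x + y)

theorem hexDispersion_eq_normSq (x y : ℝ) :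
    hexDispersion x y =
      Complex.normSq (1 + Complex.exp (x * Complex.I) + (Complex.exp (y * Complex.I))⁻¹) := by
  rw [← Complex.exp_neg, ← neg_mul, ← Complex.ofReal_neg, Complex.exp_mul_I, Complex.exp_mul_I,
    ← Complex.ofReal_cos, ← Complex.ofReal_sin, ← Complex.ofReal_cos, ← Complex.ofReal_sin,
    Complex.normSq_apply]
  simp [hexDispersion, Real.cos_add]
  simp only [Complex.cos_ofReal_re, Complex.sin_ofReal_re]
  nlinarith [Real.sin_sq_add_cos_sq x, Real.sin_sq_add_cos_sq y]

theorem hexDispersion_nonneg (x y : ℝ) : 0 ≤ hexDispersion x y := by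
  rw [hexDispersion_eq_normSq]
  exact Complex.normSq_nonneg _

/-- The sum of the square roots of the two eigenvalues of the Laplacian at wave vector `(x, y)`. -/
noncomputable def hexSqrtSum (x y : ℝ) : ℝ :=
  √(3 + √(hexDispersion x y)) + √(3 - √(hexDispersion x y))

theorem charpoly_hexSymbol_exp (x y : ℝ) :
    (hexSymbol (Complex.exp (x * Complex.I)) (Complex.exp (y * Complex.I))⁻¹).charpoly =
      ((X - C (3 + √(hexDispersion x y))) * (X - C (3 - √(hexDispersion x y)))).map
        (algebraMap ℝ ℂ) := by
  have h : (1 + Complex.exp (x * Complex.I) + (Complex.exp (y * Complex.I))⁻¹) *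
      (1 + (Complex.exp (x * Complex.I))⁻¹ + (Complex.exp (y * Complex.I))⁻¹⁻¹) =
        ((√(hexDispersion x y) : ℝ) : ℂ) ^ 2 := by
    rw [← Complex.ofReal_pow, Real.sq_sqrt (hexDispersion_nonneg x y), hexDispersion_eq_normSq,
      Complex.normSq_eq_conj_mul_self, mul_comm]
    congr 1
    simp [← Complex.exp_neg, ← Complex.exp_conj]
  rw [charpoly_hexSymbol, h]
  simp only [Polynomial.map_mul, Polynomial.map_sub, Polynomial.map_add, map_X, map_C,
    Complex.coe_algebraMap, C_add, C_sub, C_pow]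
  have : ((3 : ℝ) : ℂ) = 3 := by norm_num
  rw [this]
  ring

theorem LEL_hexTorus {m n : ℕ} (hm : m ≠ 0) (hn : n ≠ 0) :
    LEL (hexTorus m n) = ∑ a : Fin (m + 1), ∑ b : Fin (n + 1),
      hexSqrtSum (2 * Real.pi * a / (m + 1)) (2 * Real.pi * b / (n + 1)) := by
  classical
  have hζ := Complex.isPrimitiveRoot_exp (m + 1) (Nat.succ_ne_zero m)
  -- The inverse root makes the second phase `exp (-iy)`, which produces `cos (x + y)` rather than
  -- `cos (x - y)`.
  have hξ := (Complex.isPrimitiveRoot_exp (n + 1) (Nat.succ_ne_zero n)).inv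
  have e1 : ∀ (N : ℕ) (a : ℕ), Complex.exp (2 * Real.pi * Complex.I / (N + 1 : ℕ)) ^ a =
      Complex.exp ((2 * Real.pi * a / (N + 1) : ℝ) * Complex.I) := by
    intro N a
    rw [← Complex.exp_nat_mul]
    congr 1
    push_cast
    ring
  have hc : ((hexTorus m n).lapMatrix ℝ).charpoly =
      ∏ k : Fin (m + 1) × Fin (n + 1),
        ((X - C (3 + √(hexDispersion (2 * Real.pi * k.1 / (m + 1)) (2 * Real.pi * k.2 / (n + 1))))) *
        (X - C (3 - √(hexDispersion (2 * Real.pi * k.1 / (m + 1))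
          (2 * Real.pi * k.2 / (n + 1)))))) := by
    -- The diagonalisation lives over `ℂ`, but the resulting factors are real, so the factorisation
    -- descends to `ℝ`.
    apply Polynomial.map_injective (algebraMap ℝ ℂ) (algebraMap ℝ ℂ).injective
    rw [Polynomial.map_prod, ← charpoly_map]
    have hL : ((hexTorus m n).lapMatrix ℝ).map (algebraMap ℝ ℂ) =
        (hexTorus m n).lapMatrix ℂ := by
      ext u v
      simp [SimpleGraph.lapMatrix, SimpleGraph.degMatrix, diagonal_apply,
        SimpleGraph.adjMatrix_apply]
      split_ifs <;> simp
    rw [hL, charpoly_lapMatrix_hexTorus hm hn hζ hξ]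
    refine Finset.prod_congr rfl fun k _ => ?_
    rw [← charpoly_hexSymbol_exp, inv_pow, e1, e1]
  have hne : ∀ a b : ℝ, (X - C a) * (X - C b) ≠ 0 := fun a b =>
    mul_ne_zero (X_sub_C_ne_zero a) (X_sub_C_ne_zero b)
  rw [LEL_eq_sum_roots, hc, roots_prod _ _ (Finset.prod_ne_zero_iff.2 fun k _ => hne _ _),
    Multiset.map_bind, Multiset.sum_bind, ← Finset.sum_product', Finset.univ_product_univ]
  refine Finset.sum_congr rfl fun k _ => ?_
  rw [roots_mul (hne _ _), roots_X_sub_C, roots_X_sub_C]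
  simp [hexSqrtSum]

end TorusSpectrum

/-! ### Convergence of two-dimensional Riemann sums -/

section RiemannSums

open intervalIntegral

/-- Mean over one period `[0, 2π]`. -/
noncomputable def periodMean (f : ℝ → ℝ) : ℝ := (2 * Real.pi)⁻¹ * ∫ x in (0 : ℝ)..2 * Real.pi, f x

/-- Mean over the `N + 1` equidistant points of `[0, 2π)`. -/
noncomputable def gridMean (N : ℕ) (f : ℝ → ℝ) : ℝ :=
  ((N : ℝ) + 1)⁻¹ * ∑ b : Fin (N + 1), f (2 * Real.pi * b / (N + 1))

theorem gridMean_sub (N : ℕ) (f g : ℝ → ℝ) :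
    gridMean N (fun x => f x - g x) = gridMean N f - gridMean N g := by
  simp [gridMean, Finset.sum_sub_distrib, mul_sub]

theorem gridPoint_mem {N k : ℕ} (hk : k ≤ N + 1) :
    2 * Real.pi * k / (N + 1) ∈ Set.Icc (0 : ℝ) (2 * Real.pi) := by
  have := Real.pi_pos
  refine ⟨by positivity, ?_⟩
  rw [div_le_iff₀ (by positivity)]
  have : (k : ℝ) ≤ N + 1 := by exact_mod_cast hk
  gcongr

theorem abs_gridMean_le {N : ℕ} {f : ℝ → ℝ} {ε : ℝ}
    (h : ∀ x ∈ Set.Icc (0 : ℝ) (2 * Real.pi), |f x| ≤ ε) : |gridMean N f| ≤ ε := by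
  rw [gridMean, abs_mul, abs_of_pos (by positivity), inv_mul_le_iff₀ (by positivity)]
  refine (Finset.abs_sum_le_sum_abs _ _).trans ?_
  refine (Finset.sum_le_card_nsmul _ _ ε fun b _ => h _ (gridPoint_mem b.2.le)).trans ?_
  simp

theorem abs_periodMean_le {f : ℝ → ℝ} {ε : ℝ}
    (h : ∀ x ∈ Set.Icc (0 : ℝ) (2 * Real.pi), |f x| ≤ ε) : |periodMean f| ≤ ε := by
  have hp : 0 < 2 * Real.pi := Real.two_pi_pos
  have := norm_integral_le_of_norm_le_const (a := 0) (b := 2 * Real.pi) (f := f) (C := ε)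
    fun x hx => h x (by rw [Set.uIoc_of_le hp.le] at hx; exact ⟨hx.1.le, hx.2⟩)
  rw [periodMean, abs_mul, abs_of_pos (by positivity), inv_mul_le_iff₀ hp]
  simpa [abs_of_pos Real.pi_pos, mul_comm, mul_left_comm] using this

theorem periodMean_sub {f g : ℝ → ℝ} (hf : Continuous f) (hg : Continuous g) :
    periodMean (fun x => f x - g x) = periodMean f - periodMean g := by
  rw [periodMean, integral_sub (hf.intervalIntegrable _ _) (hg.intervalIntegrable _ _), mul_sub]
  rfl

theorem abs_gridMean_sub_periodMean_le {f : ℝ → ℝ} (hf : Continuous f) {ε δ : ℝ}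
    (h : ∀ s ∈ Set.Icc (0 : ℝ) (2 * Real.pi), ∀ t ∈ Set.Icc (0 : ℝ) (2 * Real.pi),
      |s - t| ≤ δ → |f s - f t| ≤ ε) {N : ℕ} (hN : 2 * Real.pi / (N + 1) ≤ δ) :
    |gridMean N f - periodMean f| ≤ ε := by
  have hp : 0 < 2 * Real.pi := Real.two_pi_pos
  have hN0 : (0 : ℝ) < (N : ℝ) + 1 := by positivity
  set a : ℕ → ℝ := fun k => 2 * Real.pi * k / (N + 1) with ha
  have hstep : ∀ k, a (k + 1) - a k = 2 * Real.pi / (N + 1) := fun k => by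
    simp only [ha]; push_cast; ring
  have hmono : ∀ k, a k ≤ a (k + 1) := fun k => by
    have := hstep k
    have : 0 < 2 * Real.pi / (N + 1) := by positivity
    linarith
  have hsplit : ∫ x in (0 : ℝ)..2 * Real.pi, f x =
      ∑ k ∈ Finset.range (N + 1), ∫ x in a k..a (k + 1), f x := by
    rw [sum_integral_adjacent_intervals fun k _ => hf.intervalIntegrable _ _]
    congr 1
    · simp [ha]
    · simp only [ha]; push_cast; field_simp
  have hpiece : ∀ k ∈ Finset.range (N + 1),
      |2 * Real.pi / (N + 1) * f (a k) - ∫ x in a k..a (k + 1), f x| ≤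
        2 * Real.pi / (N + 1) * ε := by
    intro k hk
    rw [Finset.mem_range] at hk
    have h1 : 2 * Real.pi / (N + 1) * f (a k) - ∫ x in a k..a (k + 1), f x =
        ∫ x in a k..a (k + 1), (f (a k) - f x) := by
      rw [integral_sub (by simp) (hf.intervalIntegrable _ _), integral_const, hstep, smul_eq_mul]
    rw [h1]
    rw [← Real.norm_eq_abs]
    refine (norm_integral_le_of_norm_le_const (C := ε) fun x hx => ?_).trans_eq ?_
    · rw [Set.uIoc_of_le (hmono k)] at hx
      refine h _ (gridPoint_mem hk.le) _ ⟨(gridPoint_mem hk.le).1.trans hx.1.le,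
        hx.2.trans (gridPoint_mem (k := k + 1) hk).2⟩ ?_
      rw [abs_sub_comm, abs_of_pos (by linarith [hx.1])]
      linarith [hstep k, hx.2]
    · rw [hstep, abs_of_pos (by positivity), mul_comm]
  have hsum : gridMean N f - periodMean f = (2 * Real.pi)⁻¹ * ∑ k ∈ Finset.range (N + 1),
      (2 * Real.pi / (N + 1) * f (a k) - ∫ x in a k..a (k + 1), f x) := by
    rw [Finset.sum_sub_distrib, ← hsplit, ← Finset.mul_sum, mul_sub, gridMean, periodMean,
      Finset.sum_range]
    congr 1
    rw [← mul_assoc]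
    congr 1
    field_simp
  rw [hsum, abs_mul, abs_of_pos (by positivity), inv_mul_le_iff₀ hp]
  refine (Finset.abs_sum_le_sum_abs _ _).trans ((Finset.sum_le_sum hpiece).trans_eq ?_)
  rw [Finset.sum_const, Finset.card_range, nsmul_eq_mul]
  push_cast
  field_simp

theorem continuous_periodMean {f : ℝ → ℝ → ℝ} (hf : Continuous (Function.uncurry f)) :
    Continuous fun x => periodMean (f x) :=
  continuous_const.mul (continuous_parametric_intervalIntegral_of_continuous' hf _ _)

theorem tendsto_gridMean_gridMean {f : ℝ → ℝ → ℝ} (hf : Continuous (Function.uncurry f)) :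
    Tendsto (fun p : ℕ × ℕ => gridMean p.1 fun x => gridMean p.2 (f x)) atTop
      (𝓝 (periodMean fun x => periodMean (f x))) := by
  have hfx : ∀ x, Continuous (f x) := fun x => hf.comp (by fun_prop : Continuous fun y => (x, y))
  rw [Metric.tendsto_atTop]
  intro ε hε
  have hK : IsCompact (Set.Icc (0 : ℝ) (2 * Real.pi) ×ˢ Set.Icc (0 : ℝ) (2 * Real.pi)) :=
    isCompact_Icc.prod isCompact_Icc
  obtain ⟨δ, hδ, hunif⟩ := Metric.uniformContinuousOn_iff.1
    (hK.uniformContinuousOn_of_continuous hf.continuousOn) (ε / 4) (by positivity)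
  have hmod : ∀ x ∈ Set.Icc (0 : ℝ) (2 * Real.pi), ∀ y ∈ Set.Icc (0 : ℝ) (2 * Real.pi),
      ∀ x' ∈ Set.Icc (0 : ℝ) (2 * Real.pi), ∀ y' ∈ Set.Icc (0 : ℝ) (2 * Real.pi),
      |x - x'| ≤ δ / 2 → |y - y'| ≤ δ / 2 → |f x y - f x' y'| ≤ ε / 4 := by
    intro x hx y hy x' hx' y' hy' h1 h2
    refine (hunif (x, y) ⟨hx, hy⟩ (x', y') ⟨hx', hy'⟩ ?_).le
    rw [Prod.dist_eq, max_lt_iff, Real.dist_eq, Real.dist_eq]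
    constructor <;> simp only <;> linarith
  obtain ⟨N₀, hN₀⟩ := exists_nat_gt (2 * Real.pi / (δ / 2))
  have hN : ∀ N ≥ N₀, 2 * Real.pi / ((N : ℝ) + 1) ≤ δ / 2 := by
    intro N hN
    rw [div_le_iff₀ (by positivity)]
    rw [div_lt_iff₀ (by positivity)] at hN₀
    have : (N₀ : ℝ) ≤ N := by exact_mod_cast hN
    nlinarith
  refine ⟨(N₀, N₀), fun p hp => ?_⟩
  have h1 : |gridMean p.1 (fun x => gridMean p.2 (f x)) -
      gridMean p.1 (fun x => periodMean (f x))| ≤ ε / 4 := by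
    rw [← gridMean_sub]
    refine abs_gridMean_le fun x hx => ?_
    refine abs_gridMean_sub_periodMean_le (hfx x) (fun s hs t ht hst => ?_) (hN p.2 hp.2)
    exact hmod x hx s hs x hx t ht (by simpa using by positivity) hst
  have h2 : |gridMean p.1 (fun x => periodMean (f x)) -
      periodMean (fun x => periodMean (f x))| ≤ ε / 4 := by
    refine abs_gridMean_sub_periodMean_le (continuous_periodMean hf)
      (fun s hs t ht hst => ?_) (hN p.1 hp.1)
    rw [← periodMean_sub (hfx s) (hfx t)]
    exact abs_periodMean_le fun y hy =>
      hmod s hs y hy t ht y hy hst (by simpa using by positivity)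
  rw [Real.dist_eq]
  have := abs_sub_le (gridMean p.1 fun x => gridMean p.2 (f x))
    (gridMean p.1 fun x => periodMean (f x)) (periodMean fun x => periodMean (f x))
  linarith

end RiemannSums

/-! ### The joint limit for the torus -/

section Density

open intervalIntegral

theorem continuous_hexDispersion : Continuous (Function.uncurry hexDispersion) := by
  unfold hexDispersion Function.uncurry
  fun_prop

theorem continuous_hexSqrtSum : Continuous (Function.uncurry hexSqrtSum) := by
  have := continuous_hexDispersion
  unfold hexSqrtSum Function.uncurry at *
  fun_prop

theorem hexLELDensity_eq_periodMean :
    hexLELDensity = 2⁻¹ * periodMean fun x => periodMean (hexSqrtSum x) := by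
  have hc : Continuous (Function.uncurry fun x y : ℝ => √(3 + √(hexDispersion x y))) := by
    have := continuous_hexDispersion
    unfold Function.uncurry at *
    fun_prop
  have hc' : Continuous (Function.uncurry fun x y : ℝ => √(3 - √(hexDispersion x y))) := by
    have := continuous_hexDispersion
    unfold Function.uncurry at *
    fun_prop
  have hx : ∀ x, ∫ y in (0 : ℝ)..2 * Real.pi, hexSqrtSum x y =
      (∫ y in (0 : ℝ)..2 * Real.pi, √(3 + √(hexDispersion x y))) +
        ∫ y in (0 : ℝ)..2 * Real.pi, √(3 - √(hexDispersion x y)) := fun x =>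
    integral_add
      ((hc.comp (by fun_prop : Continuous fun y => (x, y))).intervalIntegrable _ _)
      ((hc'.comp (by fun_prop : Continuous fun y => (x, y))).intervalIntegrable _ _)
  simp only [periodMean, hx, integral_const_mul]
  rw [integral_add
    ((continuous_parametric_intervalIntegral_of_continuous' hc _ _).intervalIntegrable _ _)
    ((continuous_parametric_intervalIntegral_of_continuous' hc' _ _).intervalIntegrable _ _)]
  simp only [hexLELDensity, hexDispersion]
  field_simp
  ring

theorem tendsto_normalized_hexTorus :
    Tendsto (fun p : ℕ × ℕ => LEL (hexTorus p.1 p.2) / (2 * ((p.1 : ℝ) + 1) * ((p.2 : ℝ) + 1)))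
      atTop (𝓝 hexLELDensity) := by
  rw [hexLELDensity_eq_periodMean]
  refine ((tendsto_gridMean_gridMean continuous_hexSqrtSum).const_mul 2⁻¹).congr' ?_
  filter_upwards [eventually_ge_atTop ((1, 1) : ℕ × ℕ)] with p hp
  rw [LEL_hexTorus (Nat.one_le_iff_ne_zero.1 hp.1) (Nat.one_le_iff_ne_zero.1 hp.2)]
  simp only [gridMean, ← Finset.mul_sum]
  field_simp

end Density

/-! ### Moments of the dispersion -/

section Moments

open intervalIntegral

theorem integral_exp_int_mul (n : ℤ) :
    ∫ y in (0 : ℝ)..2 * Real.pi, Complex.exp (n * Complex.I * y) =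
      if n = 0 then (2 * Real.pi : ℂ) else 0 := by
  split_ifs with h
  · simp [h]
  · rw [integral_exp_mul_complex (by simp [h])]
    have : (n * Complex.I * (2 * Real.pi : ℝ) : ℂ) = n * (2 * Real.pi * Complex.I) := by
      push_cast; ring
    rw [this, Complex.exp_int_mul_two_pi_mul_I]
    simp

/-- Parseval's identity for the binomial expansion of `(w + exp (iy)) ^ k`: only the diagonal terms
survive integration. -/
theorem periodMean_normSq_add_exp_pow (w : ℂ) (k : ℕ) :
    periodMean (fun y => Complex.normSq (w + Complex.exp (y * Complex.I)) ^ k) =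
      ∑ j ∈ Finset.range (k + 1), (k.choose j : ℝ) ^ 2 * Complex.normSq w ^ j := by
  have hexp : ∀ y : ℝ, ((Complex.normSq (w + Complex.exp (y * Complex.I)) ^ k : ℝ) : ℂ) =
      ∑ j ∈ Finset.range (k + 1), ∑ l ∈ Finset.range (k + 1),
        (w ^ j * (starRingEnd ℂ w) ^ l * k.choose j * k.choose l) *
          Complex.exp (((l : ℤ) - (j : ℤ) : ℤ) * Complex.I * y) := by
    intro y
    push_cast
    rw [Complex.normSq_eq_conj_mul_self, mul_comm, mul_pow, map_add, add_pow, add_pow,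
      Finset.sum_mul_sum]
    refine Finset.sum_congr rfl fun j hj => Finset.sum_congr rfl fun l hl => ?_
    rw [Finset.mem_range, Nat.lt_succ_iff] at hj hl
    have e : Complex.exp (y * Complex.I) ^ (k - j) *
        (starRingEnd ℂ) (Complex.exp (y * Complex.I)) ^ (k - l) =
          Complex.exp (((l : ℂ) - (j : ℂ)) * Complex.I * y) := by
      rw [← Complex.exp_conj, ← Complex.exp_nat_mul, ← Complex.exp_nat_mul, ← Complex.exp_add]
      congr 1
      simp only [map_mul, Complex.conj_ofReal, Complex.conj_I]
      push_cast [hj, hl]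
      ring
    rw [← e]
    ring
  apply Complex.ofReal_injective
  rw [periodMean, Complex.ofReal_mul, ← intervalIntegral.integral_ofReal]
  simp_rw [hexp]
  have hint : ∀ (c : ℂ) (n : ℤ), IntervalIntegrable
      (fun y : ℝ => c * Complex.exp (n * Complex.I * y)) MeasureTheory.volume 0 (2 * Real.pi) :=
    fun c n => Continuous.intervalIntegrable (by fun_prop) _ _
  rw [integral_finsetSum fun j _ =>
    Continuous.intervalIntegrable (by fun_prop) _ _]
  simp_rw [integral_finsetSum fun l _ => hint _ _, integral_const_mul, integral_exp_int_mul]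
  push_cast
  rw [Finset.mul_sum]
  refine Finset.sum_congr rfl fun j hj => ?_
  rw [Finset.sum_eq_single_of_mem j hj]
  · have : (Real.pi : ℂ) ≠ 0 := by exact_mod_cast Real.pi_ne_zero
    rw [Complex.normSq_eq_conj_mul_self, sub_self, if_pos rfl, mul_pow]
    field_simp
  · intro l _ hl
    rw [if_neg (by omega), mul_zero]

/-- The moments of the squared modulus of `1 + exp (ix) + exp (-iy)`: the numbers of closed walks
on the honeycomb lattice. -/
def hexMoment (k : ℕ) : ℕ :=
  ∑ j ∈ Finset.range (k + 1), k.choose j ^ 2 * ∑ i ∈ Finset.range (j + 1), j.choose i ^ 2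

theorem periodMean_hexDispersion_pow (k : ℕ) :
    periodMean (fun x => periodMean fun y => hexDispersion x y ^ k) = hexMoment k := by
  -- Conjugation brings the squared modulus to the form needed to integrate out `y` with `w = 1 +
  -- exp (-ix)`; the integral over `x` is then the same lemma with `w = 1`.
  have h1 : ∀ x y : ℝ, hexDispersion x y = Complex.normSq
      ((1 + Complex.exp (-x * Complex.I)) + Complex.exp (y * Complex.I)) := by
    intro x y
    rw [hexDispersion_eq_normSq, ← Complex.normSq_conj]
    congr 1
    simp only [map_add, map_one, ← Complex.exp_neg, ← Complex.exp_conj, map_mul, map_neg,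
      Complex.conj_I, Complex.conj_ofReal]
    ring_nf
  have h2 : ∀ x : ℝ, Complex.normSq (1 + Complex.exp (-x * Complex.I)) =
      Complex.normSq (1 + Complex.exp (x * Complex.I)) := by
    intro x
    rw [← Complex.normSq_conj]
    congr 1
    simp only [map_add, map_one, ← Complex.exp_conj, map_mul, map_neg,
      Complex.conj_I, Complex.conj_ofReal]
    ring_nf
  simp_rw [h1, periodMean_normSq_add_exp_pow, h2]
  have hc : ∀ j : ℕ, Continuous fun x : ℝ => (k.choose j : ℝ) ^ 2 *
      Complex.normSq (1 + Complex.exp (x * Complex.I)) ^ j := fun j =>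
    continuous_const.mul ((Complex.continuous_normSq.comp (by fun_prop)).pow _)
  rw [periodMean, integral_finsetSum fun j _ => (hc j).intervalIntegrable _ _,
    Finset.mul_sum, hexMoment]
  push_cast
  refine Finset.sum_congr rfl fun j _ => ?_
  rw [integral_const_mul, mul_left_comm]
  have := periodMean_normSq_add_exp_pow 1 j
  rw [periodMean] at this
  rw [this]
  simp

end Moments

/-! ### Sign of the Hermite interpolation error -/

section PowerSeries

/-- `G` is the sum of a power series on `[0, 1)` whose coefficients from the `N`-th on are
nonnegative. -/
def HasNonnegTail (N : ℕ) (G : ℝ → ℝ) : Prop :=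
  ∃ b : ℕ → ℝ, (∀ k, N ≤ k → 0 ≤ b k) ∧
    ∀ r, 0 ≤ r → r < 1 → HasSum (fun k => b k * r ^ k) (G r)

namespace HasNonnegTail

variable {N : ℕ} {G : ℝ → ℝ}

theorem continuousAt (hG : HasNonnegTail N G) {t : ℝ} (h0 : 0 < t) (h1 : t < 1) :
    ContinuousAt G t := by
  obtain ⟨b, -, hb⟩ := hG
  obtain ⟨ρ, hρ0, hρ1⟩ := exists_between h1
  have hcont : ContinuousOn (fun r => ∑' k, b k * r ^ k) (Set.Icc 0 ρ) := by
    refine continuousOn_tsum (u := fun k => |b k * ρ ^ k|) (fun k => by fun_prop)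
      (hb ρ (h0.le.trans hρ0.le) hρ1).summable.abs fun k x hx => ?_
    rw [Real.norm_eq_abs, abs_mul, abs_mul, abs_pow, abs_pow, abs_of_nonneg hx.1,
      abs_of_nonneg (hx.1.trans hx.2)]
    gcongr
    exacts [hx.1, hx.2]
  refine (hcont.continuousAt (Icc_mem_nhds h0 hρ0)).congr ?_
  filter_upwards [Ioo_mem_nhds h0 h1] with r hr
  exact (hb r hr.1.le hr.2).tsum_eq

/-- Dividing by `r - t` yields the coefficients `∑ j, b (k + 1 + j) * t ^ j`. They only involve
later coefficients of `G`, with positive weights, so the nonnegative tail starts one place earlier.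
-/
theorem exists_eq_sub_mul (hG : HasNonnegTail (N + 1) G) {t : ℝ} (h0 : 0 < t) (h1 : t < 1)
    (ht : G t = 0) :
    ∃ g, HasNonnegTail N g ∧ ∀ r, 0 ≤ r → r < 1 → G r = (r - t) * g r := by
  obtain ⟨b, hb0, hb⟩ := hG
  have hsum : ∀ k, Summable fun j => b (k + j) * t ^ j := by
    intro k
    have h := ((summable_nat_add_iff k).2 (hb t h0.le h1).summable).mul_left (t ^ k)⁻¹
    refine h.congr fun j => ?_
    rw [add_comm j k, pow_add]
    field_simp
  let c : ℕ → ℝ := fun k => ∑' j, b (k + j) * t ^ j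
  have hc : ∀ k, c k = b k + t * c (k + 1) := by
    intro k
    simp only [c]
    rw [(hsum k).tsum_eq_zero_add, ← tsum_mul_left]
    simp only [add_zero, pow_zero, mul_one]
    congr 1
    refine tsum_congr fun j => ?_
    rw [show k + (j + 1) = k + 1 + j by ring]
    ring
  have hc0 : c 0 = 0 := by
    rw [← ht, ← (hb t h0.le h1).tsum_eq]
    simp [c]
  have hcsum : ∀ r, 0 ≤ r → r < 1 → Summable fun k => c (k + 1) * r ^ k := by
    intro r hr0 hr1
    -- Boundedness of `b k * ρ ^ k` gives geometric majorants with ratios `t / ρ` and `r / ρ`.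
    obtain ⟨ρ, hρ, hρ1⟩ := exists_between (max_lt h1 hr1)
    have htρ : t < ρ := (le_max_left _ _).trans_lt hρ
    have hrρ : r < ρ := (le_max_right _ _).trans_lt hρ
    have hρ0 : 0 < ρ := h0.trans htρ
    obtain ⟨C, hC⟩ := (hb ρ hρ0.le hρ1).summable.tendsto_atTop_zero.norm.bddAbove_range
    have hbC : ∀ k, |b k| * ρ ^ k ≤ C := fun k => by
      have := hC ⟨k, rfl⟩
      simpa [abs_mul, abs_of_pos hρ0] using this
    have hgeo : Summable fun j : ℕ => (t / ρ) ^ j :=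
      summable_geometric_of_lt_one (by positivity) ((div_lt_one hρ0).2 htρ)
    have hgeo' : Summable fun j : ℕ => (r / ρ) ^ j :=
      summable_geometric_of_lt_one (by positivity) ((div_lt_one hρ0).2 hrρ)
    have hcle : ∀ k, |c k| * ρ ^ k ≤ C * ∑' j : ℕ, (t / ρ) ^ j := by
      intro k
      rw [← tsum_mul_left, ← abs_of_pos (pow_pos hρ0 k), ← abs_mul, ← tsum_mul_right,
        ← Real.norm_eq_abs]
      refine tsum_of_norm_bounded (hgeo.mul_left C).hasSum fun j => ?_
      rw [Real.norm_eq_abs, abs_mul, abs_mul, abs_pow, abs_pow, abs_of_pos h0, abs_of_pos hρ0,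
        div_pow, mul_div_assoc', le_div_iff₀ (by positivity)]
      calc |b (k + j)| * t ^ j * ρ ^ k * ρ ^ j = |b (k + j)| * ρ ^ (k + j) * t ^ j := by ring
        _ ≤ C * t ^ j := by gcongr; exact hbC _
    refine .of_norm_bounded ((hgeo'.mul_left (C * ∑' j : ℕ, (t / ρ) ^ j)).mul_left ρ⁻¹)
      fun k => ?_
    rw [Real.norm_eq_abs, abs_mul, abs_pow, abs_of_nonneg hr0, div_pow, inv_mul_eq_div,
      le_div_iff₀ hρ0, mul_div_assoc', le_div_iff₀ (by positivity)]
    calc |c (k + 1)| * r ^ k * ρ * ρ ^ k = |c (k + 1)| * ρ ^ (k + 1) * r ^ k := by ring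
      _ ≤ _ := mul_le_mul_of_nonneg_right (hcle _) (by positivity)
  refine ⟨fun r => ∑' k, c (k + 1) * r ^ k, ⟨fun k => c (k + 1), fun k hk => ?_,
    fun r hr0 hr1 => (hcsum r hr0 hr1).hasSum⟩, fun r hr0 hr1 => ?_⟩
  · exact tsum_nonneg fun j => mul_nonneg (hb0 _ (by omega)) (by positivity)
  · have e0 : HasSum (fun k => c (k + 1) * r ^ k) (∑' k, c (k + 1) * r ^ k) :=
      (hcsum r hr0 hr1).hasSum
    have e1 : HasSum (fun k => c k * r ^ k) (r * ∑' k, c (k + 1) * r ^ k) := by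
      rw [← hasSum_nat_add_iff' 1]
      simp only [Finset.range_one, Finset.sum_singleton, hc0, zero_mul, sub_zero]
      refine (e0.mul_left r).congr_fun fun k => ?_
      ring
    refine (hb r hr0 hr1).unique ?_
    rw [sub_mul]
    refine (e1.sub (e0.mul_left t)).congr_fun fun k => ?_
    rw [hc k]
    ring

theorem exists_eq_sq_mul (hG : HasNonnegTail (N + 2) G) {t : ℝ} (h0 : 0 < t) (h1 : t < 1)
    (ht : G t = 0) (ht' : HasDerivAt G 0 t) :
    ∃ g, HasNonnegTail N g ∧ ∀ r, 0 ≤ r → r < 1 → G r = (r - t) ^ 2 * g r := by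
  obtain ⟨g₁, hg₁, e₁⟩ := hG.exists_eq_sub_mul h0 h1 ht
  have hz : g₁ t = 0 := by
    have hlim : Tendsto g₁ (𝓝[≠] t) (𝓝 0) := by
      refine (hasDerivAt_iff_tendsto_slope.1 ht').congr' ?_
      filter_upwards [self_mem_nhdsWithin, nhdsWithin_le_nhds (Ioo_mem_nhds h0 h1)] with r hr hr'
      rw [slope_def_field, ht, e₁ r hr'.1.le hr'.2, sub_zero,
        mul_div_cancel_left₀ _ (sub_ne_zero.2 hr)]
    exact tendsto_nhds_unique ((hg₁.continuousAt h0 h1).tendsto.mono_left nhdsWithin_le_nhds) hlim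
  obtain ⟨g, hg, e⟩ := hg₁.exists_eq_sub_mul h0 h1 hz
  refine ⟨g, hg, fun r hr0 hr1 => ?_⟩
  rw [e₁ r hr0 hr1, e r hr0 hr1]
  ring

/-- The factorisation behind the sign of the error of Hermite interpolation. -/
theorem exists_eq_prod_sq_mul (ts : List ℝ) (hnodup : ts.Nodup) :
    ∀ {G : ℝ → ℝ}, HasNonnegTail (N + 2 * ts.length) G →
      (∀ t ∈ ts, 0 < t ∧ t < 1 ∧ G t = 0 ∧ HasDerivAt G 0 t) →
      ∃ g, HasNonnegTail N g ∧
        ∀ r, 0 ≤ r → r < 1 → G r = (ts.map fun t => (r - t) ^ 2).prod * g r := by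
  induction ts with
  | nil => exact fun {G} hG _ => ⟨G, hG, by simp⟩
  | cons t ts ih =>
    intro G hG ht
    rw [List.nodup_cons] at hnodup
    obtain ⟨h0, h1, hGt, hGt'⟩ := ht t (by simp)
    obtain ⟨g₁, hg₁, e₁⟩ := HasNonnegTail.exists_eq_sq_mul (N := N + 2 * ts.length) hG h0 h1 hGt hGt'
    obtain ⟨g, hg, e⟩ := ih hnodup.2 hg₁ (by
      intro s hs
      obtain ⟨hs0, hs1, hGs, hGs'⟩ := ht s (by simp [hs])
      have hne : s - t ≠ 0 := sub_ne_zero.2 fun h => hnodup.1 (h ▸ hs)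
      -- Away from `t` the quotient is `G` times a smooth factor, so it inherits the double zeros at
      -- the other nodes.
      have hev : ∀ r, 0 ≤ r → r < 1 → r - t ≠ 0 → g₁ r = G r * ((r - t) ^ 2)⁻¹ := by
        intro r hr0 hr1 hrt
        rw [e₁ r hr0 hr1, mul_comm, inv_mul_cancel_left₀ (pow_ne_zero 2 hrt)]
      refine ⟨hs0, hs1, by rw [hev s hs0.le hs1 hne, hGs, zero_mul], ?_⟩
      have hd : DifferentiableAt ℝ (fun r : ℝ => ((r - t) ^ 2)⁻¹) s :=
        ((differentiableAt_id.sub_const t).pow 2).inv (pow_ne_zero 2 hne)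
      have hprod := hGs'.mul hd.hasDerivAt
      rw [hGs, zero_mul, zero_mul, add_zero] at hprod
      refine hprod.congr_of_eventuallyEq ?_
      filter_upwards [Ioo_mem_nhds hs0 hs1, (continuous_id.sub continuous_const).continuousAt.eventually_ne hne]
        with r hr hr'
      exact hev r hr.1.le hr.2 hr')
    refine ⟨g, hg, fun r hr0 hr1 => ?_⟩
    rw [e₁ r hr0 hr1, e r hr0 hr1, List.map_cons, List.prod_cons]
    ring

theorem nonneg (hG : HasNonnegTail 0 G) {r : ℝ} (h0 : 0 ≤ r) (h1 : r < 1) : 0 ≤ G r := by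
  obtain ⟨b, hb0, hb⟩ := hG
  exact (hb r h0 h1).nonneg fun k => mul_nonneg (hb0 k k.zero_le) (by positivity)

theorem monotone (hG : HasNonnegTail 1 G) {r s : ℝ} (h0 : 0 ≤ r) (hrs : r ≤ s) (h1 : s < 1) :
    G r ≤ G s := by
  obtain ⟨b, hb0, hb⟩ := hG
  refine hasSum_le (fun k => ?_) (hb r h0 (hrs.trans_lt h1)) (hb s (h0.trans hrs) h1)
  rcases k with _ | k
  · simp
  · have := hb0 (k + 1) (by omega)
    gcongr

theorem prod_sq_nonneg (ts : List ℝ) (r : ℝ) : 0 ≤ (ts.map fun t => (r - t) ^ 2).prod := by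
  refine List.prod_nonneg fun x hx => ?_
  obtain ⟨t, -, rfl⟩ := List.mem_map.1 hx
  positivity

theorem nonneg_of_double_zeros {ts : List ℝ} (hnodup : ts.Nodup)
    (hG : HasNonnegTail (2 * ts.length) G)
    (ht : ∀ t ∈ ts, 0 < t ∧ t < 1 ∧ G t = 0 ∧ HasDerivAt G 0 t) {r : ℝ} (h0 : 0 ≤ r)
    (h1 : r < 1) : 0 ≤ G r := by
  obtain ⟨g, hg, e⟩ := exists_eq_prod_sq_mul (N := 0) ts hnodup (by rwa [zero_add]) ht
  rw [e r h0 h1]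
  exact mul_nonneg (prod_sq_nonneg _ _) (hg.nonneg h0 h1)

/-- One coefficient of unknown sign remains in the cofactor `g`, which is therefore only known to be
monotone. A positive value of `g` would persist up to `1` and contradict `G 1 ≤ 0`. -/
theorem nonpos_of_double_zeros {ts : List ℝ} (hnodup : ts.Nodup)
    (hG : HasNonnegTail (1 + 2 * ts.length) G)
    (ht : ∀ t ∈ ts, 0 < t ∧ t < 1 ∧ G t = 0 ∧ HasDerivAt G 0 t) (hG1 : G 1 ≤ 0)
    (hcont : ContinuousAt G 1) {r : ℝ} (h0 : 0 ≤ r) (h1 : r < 1) : G r ≤ 0 := by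
  obtain ⟨g, hg, e⟩ := exists_eq_prod_sq_mul (N := 1) ts hnodup hG ht
  rw [e r h0 h1]
  refine mul_nonpos_of_nonneg_of_nonpos (prod_sq_nonneg _ _) ?_
  by_contra! hpos
  have hω : Continuous fun s : ℝ => (ts.map fun t => (s - t) ^ 2).prod :=
    continuous_list_prod _ fun t _ => by fun_prop
  have hlim : (ts.map fun t => (1 - t) ^ 2).prod * g r ≤ G 1 := by
    refine le_of_tendsto_of_tendsto (b := 𝓝[<] (1 : ℝ))
      ((hω.tendsto 1).mono_left nhdsWithin_le_nhds |>.mul_const (g r))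
      (hcont.tendsto.mono_left nhdsWithin_le_nhds) ?_
    filter_upwards [Ioo_mem_nhdsLT h1] with s hs
    rw [e s (h0.trans hs.1.le) hs.2]
    exact mul_le_mul_of_nonneg_left (hg.monotone h0 hs.1.le hs.2) (prod_sq_nonneg _ _)
  have hpos1 : 0 < (ts.map fun t => (1 - t) ^ 2).prod := by
    refine List.prod_pos fun x hx => ?_
    obtain ⟨t, htm, rfl⟩ := List.mem_map.1 hx
    have := (ht t htm).2.1
    exact pow_pos (by linarith) 2
  nlinarith [mul_pos hpos1 hpos]

end HasNonnegTail

end PowerSeries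

/-! ### The profile function and its Taylor coefficients -/

section Profile

/-- The function `√((1 + √(1 - r)) / 2)`, which is `cos (φ / 2)` at `r = sin² φ`. -/
noncomputable def sqrtProfile (r : ℝ) : ℝ := √((1 + √(1 - r)) / 2)

theorem continuous_sqrtProfile : Continuous sqrtProfile := by
  unfold sqrtProfile
  fun_prop

theorem sqrtProfile_sq {z : ℝ} (h0 : 0 ≤ z) (h1 : z ≤ 1) :
    sqrtProfile (z ^ 2) = (√(1 + z) + √(1 - z)) / 2 := by
  have h : 1 - z ^ 2 = (1 + z) * (1 - z) := by ring
  rw [sqrtProfile, h, Real.sqrt_mul (by linarith), Real.sqrt_eq_iff_mul_self_eq (by positivity)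
    (by positivity)]
  have e1 := Real.mul_self_sqrt (show 0 ≤ 1 + z by linarith)
  have e2 := Real.mul_self_sqrt (show 0 ≤ 1 - z by linarith)
  linear_combination -(e1 + e2) / 4

theorem descPochhammer_half_even_nonpos (k : ℕ) :
    (descPochhammer ℤ (2 * (k + 1))).smeval (1 / 2 : ℝ) ≤ 0 := by
  have step : ∀ n, (descPochhammer ℤ (n + 1)).smeval (1 / 2 : ℝ) =
      (descPochhammer ℤ n).smeval (1 / 2 : ℝ) * (1 / 2 - n) := by
    intro n
    rw [descPochhammer_succ_right, Polynomial.smeval_mul, Polynomial.smeval_sub,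
      Polynomial.smeval_X, Polynomial.smeval_natCast]
    simp
  induction k with
  | zero =>
    rw [show 2 * (0 + 1) = 0 + 1 + 1 by rfl, step, step, descPochhammer_zero,
      Polynomial.smeval_one]
    norm_num
  | succ k ih =>
    rw [show 2 * (k + 1 + 1) = 2 * (k + 1) + 1 + 1 by ring, step, step, mul_assoc]
    -- The two new factors are both negative.
    refine mul_nonpos_of_nonpos_of_nonneg ih ?_
    push_cast
    have : (0 : ℝ) ≤ k := k.cast_nonneg
    nlinarith

theorem choose_half_even_nonpos (k : ℕ) : Ring.choose (1 / 2 : ℝ) (2 * (k + 1)) ≤ 0 := by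
  have h := descPochhammer_half_even_nonpos k
  rw [Ring.descPochhammer_eq_factorial_smul_choose, nsmul_eq_mul] at h
  exact nonpos_of_mul_nonpos_right h (by positivity)

theorem hasSum_sqrt_one_add {z : ℝ} (h : |z| < 1) :
    HasSum (fun n => Ring.choose (1 / 2 : ℝ) n * z ^ n) √(1 + z) := by
  have := (Real.one_add_rpow_hasFPowerSeriesOnBall_zero (a := 1 / 2)).hasSum (y := z)
    (by simpa [edist_dist, Real.norm_eq_abs] using h)
  simpa only [zero_add, ← Real.sqrt_eq_rpow, binomialSeries_apply, smul_eq_mul, List.ofFn_const,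
    List.prod_replicate] using this

/-- At `r = z ^ 2` the profile is the even part of `√(1 + z)`, so its series consists of the even
binomial coefficients. -/
theorem hasSum_sqrtProfile {r : ℝ} (h0 : 0 ≤ r) (h1 : r < 1) :
    HasSum (fun k => Ring.choose (1 / 2 : ℝ) (2 * k) * r ^ k) (sqrtProfile r) := by
  obtain ⟨z, hz0, rfl⟩ : ∃ z, 0 ≤ z ∧ z ^ 2 = r := ⟨√r, Real.sqrt_nonneg r, Real.sq_sqrt h0⟩
  have hz1 : z < 1 := by nlinarith
  rw [sqrtProfile_sq hz0 hz1.le]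
  have hp := hasSum_sqrt_one_add (z := z) (by rwa [abs_of_nonneg hz0])
  have hm := hasSum_sqrt_one_add (z := -z) (by rwa [abs_neg, abs_of_nonneg hz0])
  have hs := (hp.add hm).div_const 2
  rw [← sub_eq_add_neg] at hs
  rw [← (mul_right_injective₀ (two_ne_zero' ℕ)).hasSum_iff] at hs
  · refine hs.congr_fun fun k => ?_
    simp only [Function.comp_apply]
    rw [Even.neg_pow (even_two_mul k), pow_mul]
    ring
  · intro n hn
    have hodd : Odd n := by
      rw [← Nat.not_even_iff_odd, even_iff_exists_two_mul]
      rintro ⟨k, rfl⟩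
      exact hn ⟨k, rfl⟩
    rw [hodd.neg_pow]
    ring

/-- With `c = cos (φ / 2)` the node is `sin² φ`. Parametrising nodes by the value `c` makes node,
value and slope rational together. -/
theorem sqrtProfile_node {c : ℝ} (h0 : 0 ≤ c) (h : 0 ≤ 2 * c ^ 2 - 1) :
    sqrtProfile (1 - (2 * c ^ 2 - 1) ^ 2) = c := by
  rw [sqrtProfile, sub_sub_cancel, Real.sqrt_sq h, show (1 + (2 * c ^ 2 - 1)) / 2 = c ^ 2 by ring,
    Real.sqrt_sq h0]

theorem hasDerivAt_sqrtProfile_node {c : ℝ} (h0 : 0 < c) (h : 0 < 2 * c ^ 2 - 1) :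
    HasDerivAt sqrtProfile (-1 / (8 * c * (2 * c ^ 2 - 1))) (1 - (2 * c ^ 2 - 1) ^ 2) := by
  have e1 : √(1 - (1 - (2 * c ^ 2 - 1) ^ 2)) = 2 * c ^ 2 - 1 := by
    rw [sub_sub_cancel, Real.sqrt_sq h.le]
  have d1 : HasDerivAt (fun r : ℝ => (1 + √(1 - r)) / 2) (-1 / (2 * (2 * c ^ 2 - 1)) / 2)
      (1 - (2 * c ^ 2 - 1) ^ 2) := by
    have := ((hasDerivAt_id (1 - (2 * c ^ 2 - 1) ^ 2)).const_sub 1).sqrt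
      (by simp only [id]; rw [sub_sub_cancel]; positivity)
    simp only [id, e1] at this
    exact (this.const_add 1).div_const 2
  have hval : (1 + √(1 - (1 - (2 * c ^ 2 - 1) ^ 2))) / 2 = c ^ 2 := by rw [e1]; ring
  have := d1.sqrt (by rw [hval]; positivity)
  rw [hval, Real.sqrt_sq h0.le] at this
  exact this.congr_deriv (by field_simp; norm_num)

theorem hexDispersion_le (x y : ℝ) : hexDispersion x y ≤ 9 := by
  have := Real.cos_le_one x
  have := Real.cos_le_one y
  have := Real.cos_le_one (x + y)
  unfold hexDispersion
  linarith

theorem hexSqrtSum_eq (x y : ℝ) :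
    hexSqrtSum x y = 2 * √3 * sqrtProfile (hexDispersion x y / 9) := by
  have h0 := hexDispersion_nonneg x y
  have h9 := hexDispersion_le x y
  set z := √(hexDispersion x y) / 3 with hz
  have hz2 : hexDispersion x y / 9 = z ^ 2 := by
    rw [hz, div_pow, Real.sq_sqrt h0]; norm_num
  have hz0 : 0 ≤ z := by positivity
  have hz1 : z ≤ 1 := by
    rw [hz, div_le_one (by norm_num), Real.sqrt_le_left (by norm_num)]
    linarith
  have hs : √(hexDispersion x y) = 3 * z := by rw [hz]; ring
  rw [hz2, sqrtProfile_sq hz0 hz1, hexSqrtSum, hs, show 3 + 3 * z = 3 * (1 + z) by ring,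
    show 3 - 3 * z = 3 * (1 - z) by ring, Real.sqrt_mul (by norm_num), Real.sqrt_mul (by norm_num)]
  ring

end Profile

/-! ### Means over the torus -/

section TorusMean

open intervalIntegral

/-- Mean of a doubly periodic function. -/
noncomputable def torusMean (f : ℝ → ℝ → ℝ) : ℝ := periodMean fun x => periodMean (f x)

theorem periodMean_add {f g : ℝ → ℝ} (hf : Continuous f) (hg : Continuous g) :
    periodMean (fun x => f x + g x) = periodMean f + periodMean g := by
  rw [periodMean, integral_add (hf.intervalIntegrable _ _) (hg.intervalIntegrable _ _), mul_add]
  rfl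

theorem periodMean_const_mul (c : ℝ) (f : ℝ → ℝ) :
    periodMean (fun x => c * f x) = c * periodMean f := by
  rw [periodMean, periodMean, integral_const_mul, mul_left_comm]

theorem periodMean_mono {f g : ℝ → ℝ} (hf : Continuous f) (hg : Continuous g)
    (h : ∀ x, f x ≤ g x) : periodMean f ≤ periodMean g := by
  have := Real.pi_pos
  unfold periodMean
  gcongr
  exact integral_mono (by positivity) (hf.intervalIntegrable _ _) (hg.intervalIntegrable _ _) h

theorem continuous_section {f : ℝ → ℝ → ℝ} (hf : Continuous (Function.uncurry f)) (x : ℝ) :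
    Continuous (f x) :=
  hf.comp (by fun_prop : Continuous fun y => (x, y))

theorem torusMean_add {f g : ℝ → ℝ → ℝ} (hf : Continuous (Function.uncurry f))
    (hg : Continuous (Function.uncurry g)) :
    torusMean (fun x y => f x y + g x y) = torusMean f + torusMean g := by
  simp only [torusMean, fun x => periodMean_add (continuous_section hf x) (continuous_section hg x)]
  exact periodMean_add (continuous_periodMean hf) (continuous_periodMean hg)

theorem torusMean_const_mul (c : ℝ) (f : ℝ → ℝ → ℝ) :
    torusMean (fun x y => c * f x y) = c * torusMean f := by
  simp only [torusMean, periodMean_const_mul]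

theorem torusMean_mono {f g : ℝ → ℝ → ℝ} (hf : Continuous (Function.uncurry f))
    (hg : Continuous (Function.uncurry g)) (h : ∀ x y, f x y ≤ g x y) :
    torusMean f ≤ torusMean g :=
  periodMean_mono (continuous_periodMean hf) (continuous_periodMean hg) fun x =>
    periodMean_mono (continuous_section hf x) (continuous_section hg x) (h x)

theorem hexLELDensity_eq_torusMean :
    hexLELDensity = √3 * torusMean fun x y => sqrtProfile (hexDispersion x y / 9) := by
  rw [hexLELDensity_eq_periodMean, ← torusMean_const_mul]
  change 2⁻¹ * torusMean hexSqrtSum = _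
  rw [← torusMean_const_mul]
  congr 1
  ext x y
  rw [hexSqrtSum_eq]
  ring

end TorusMean

/-! ### Computable polynomials over the rationals -/

section RationalPolynomials

/-- Horner evaluation of the polynomial with coefficient list `q`, constant term first. -/
def polyEval (x : ℚ) : List ℚ → ℚ
  | [] => 0
  | a :: q => a + x * polyEval x q

/-- Value of the derivative of the polynomial with coefficient list `q`. -/
def polyDeriv (x : ℚ) : List ℚ → ℚ
  | [] => 0
  | _ :: q => polyEval x q + x * polyDeriv x q

/-- The real polynomial function with coefficient list `q`. -/
noncomputable def polyFun : List ℚ → ℝ → ℝ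
  | [], _ => 0
  | a :: q, x => a + x * polyFun q x

/-- Mean over the torus of `r ^ k` times the polynomial with coefficient list `q` at `r`, where
`r` is a ninth of the dispersion. -/
def polyMean : ℕ → List ℚ → ℚ
  | _, [] => 0
  | k, a :: q => a * (hexMoment k / 9 ^ k) + polyMean (k + 1) q

theorem polyFun_ratCast (x : ℚ) (q : List ℚ) : polyFun q x = polyEval x q := by
  induction q with
  | nil => simp [polyFun, polyEval]
  | cons a q ih => simp [polyFun, polyEval, ih]

theorem hasDerivAt_polyFun (x : ℚ) (q : List ℚ) : HasDerivAt (polyFun q) (polyDeriv x q) x := by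
  induction q with
  | nil => simpa [polyDeriv] using! hasDerivAt_const (x : ℝ) (0 : ℝ)
  | cons a q ih =>
    have := ((hasDerivAt_id (x : ℝ)).mul ih).const_add (a : ℝ)
    refine this.congr_deriv ?_
    simp [polyDeriv, polyFun_ratCast]

theorem continuous_polyFun (q : List ℚ) : Continuous (polyFun q) := by
  induction q with
  | nil => exact continuous_const
  | cons a q ih => exact continuous_const.add (continuous_id.mul ih)

theorem exists_hasSum_polyFun (q : List ℚ) :
    ∃ b : ℕ → ℝ, (∀ k, q.length ≤ k → b k = 0) ∧
      ∀ r, HasSum (fun k => b k * r ^ k) (polyFun q r) := by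
  induction q with
  | nil => exact ⟨0, by simp, fun r => by simp [polyFun]⟩
  | cons a q ih =>
    obtain ⟨b, hb0, hb⟩ := ih
    refine ⟨fun k => Nat.casesOn k a b, ?_, fun r => ?_⟩
    · rintro (_ | k) hk
      · simp at hk
      · exact hb0 k (by simpa using hk)
    · rw [← hasSum_nat_add_iff' 1]
      have e : polyFun (a :: q) r - ∑ i ∈ Finset.range 1,
          (fun k => Nat.casesOn k (a : ℝ) b : ℕ → ℝ) i * r ^ i = r * polyFun q r := by
        simp [polyFun]
      rw [e]
      refine ((hb r).mul_left r).congr_fun fun k => ?_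
      ring

theorem continuous_polyFun_hexDispersion (q : List ℚ) :
    Continuous (Function.uncurry fun x y => polyFun q (hexDispersion x y / 9)) :=
  (continuous_polyFun q).comp (continuous_hexDispersion.div_const 9)

theorem torusMean_pow_mul_polyFun (k : ℕ) (q : List ℚ) :
    torusMean (fun x y => (hexDispersion x y / 9) ^ k * polyFun q (hexDispersion x y / 9)) =
      polyMean k q := by
  induction q generalizing k with
  | nil => simp [polyFun, polyMean, torusMean, periodMean]
  | cons a q ih =>
    have e : (fun x y => (hexDispersion x y / 9) ^ k * polyFun (a :: q) (hexDispersion x y / 9)) =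
        fun x y => (a / 9 ^ k : ℝ) * hexDispersion x y ^ k +
          (hexDispersion x y / 9) ^ (k + 1) * polyFun q (hexDispersion x y / 9) := by
      ext x y
      rw [polyFun, pow_succ, div_pow]
      ring
    have c1 : Continuous (Function.uncurry fun x y => (a / 9 ^ k : ℝ) * hexDispersion x y ^ k) :=
      continuous_const.mul (continuous_hexDispersion.pow k)
    have c2 : Continuous (Function.uncurry fun x y =>
        (hexDispersion x y / 9) ^ (k + 1) * polyFun q (hexDispersion x y / 9)) :=
      ((continuous_hexDispersion.div_const 9).pow (k + 1)).mul
        (continuous_polyFun_hexDispersion q)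
    rw [e, torusMean_add c1 c2,
      torusMean_const_mul, ih, torusMean, periodMean_hexDispersion_pow, polyMean]
    push_cast
    ring

theorem torusMean_polyFun (q : List ℚ) :
    torusMean (fun x y => polyFun q (hexDispersion x y / 9)) = polyMean 0 q := by
  simpa using torusMean_pow_mul_polyFun 0 q

end RationalPolynomials

/-! ### Bounds for the density from Hermite interpolants -/

section HermiteBounds

/-- The point at which `sqrtProfile` takes the value `c`. -/
def profileNode (c : ℚ) : ℚ := 1 - (2 * c ^ 2 - 1) ^ 2

/-- The derivative of `sqrtProfile` at the point where it takes the value `c`. -/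
def profileSlope (c : ℚ) : ℚ := -1 / (8 * c * (2 * c ^ 2 - 1))

/-- The polynomial with coefficients `q` agrees with `sqrtProfile` to first order at the points
where `sqrtProfile` takes the values `cs`. -/
def IsHermiteInterpolant (cs q : List ℚ) : Prop :=
  (cs.map profileNode).Nodup ∧
    ∀ c ∈ cs, (0 < c ∧ 0 < profileNode c ∧ 0 < 2 * c ^ 2 - 1) ∧
      polyEval (profileNode c) q = c ∧ polyDeriv (profileNode c) q = profileSlope c

instance (cs q : List ℚ) : Decidable (IsHermiteInterpolant cs q) :=
  inferInstanceAs (Decidable (_ ∧ _))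

/-- Beyond the degree of `q` only the negated coefficients of the profile remain. The index `0` must
be excluded, because the constant coefficient of the profile is `1`. -/
theorem hasNonnegTail_polyFun_sub_sqrtProfile {q : List ℚ} {N : ℕ} (hN : q.length ≤ N)
    (hN0 : 0 < N) : HasNonnegTail N fun r => polyFun q r - sqrtProfile r := by
  obtain ⟨b, hb0, hb⟩ := exists_hasSum_polyFun q
  refine ⟨fun k => b k - Ring.choose (1 / 2 : ℝ) (2 * k), fun k hk => ?_, fun r h0 h1 => ?_⟩
  · obtain ⟨l, rfl⟩ : ∃ l, k = l + 1 := ⟨k - 1, by omega⟩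
    simp only [hb0 _ (hN.trans hk), zero_sub]
    exact neg_nonneg.2 (choose_half_even_nonpos l)
  · simp only [sub_mul]
    exact (hb r).sub (hasSum_sqrtProfile h0 h1)

theorem IsHermiteInterpolant.double_zeros {cs q : List ℚ} (h : IsHermiteInterpolant cs q) :
    ∀ t ∈ (cs.map profileNode).map ((↑) : ℚ → ℝ), 0 < t ∧ t < 1 ∧
      polyFun q t - sqrtProfile t = 0 ∧
        HasDerivAt (fun r => polyFun q r - sqrtProfile r) 0 t := by
  intro t ht
  rw [List.map_map, List.mem_map] at ht
  obtain ⟨c, hc, rfl⟩ := ht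
  obtain ⟨⟨h0, hpos, hlow⟩, hval, hder⟩ := h.2 c hc
  have h0' : (0 : ℝ) < c := by exact_mod_cast h0
  have hlow' : (0 : ℝ) < 2 * (c : ℝ) ^ 2 - 1 := by exact_mod_cast hlow
  have e : ((profileNode c : ℚ) : ℝ) = 1 - (2 * (c : ℝ) ^ 2 - 1) ^ 2 := by
    simp [profileNode]
  have hF : sqrtProfile (profileNode c : ℚ) = c := by
    rw [e]; exact sqrtProfile_node h0'.le hlow'.le
  have hF' : HasDerivAt sqrtProfile (profileSlope c : ℚ) (profileNode c : ℚ) := by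
    rw [e]
    refine (hasDerivAt_sqrtProfile_node h0' hlow').congr_deriv ?_
    simp [profileSlope]
  refine ⟨by simpa using hpos, ?_, ?_, ?_⟩
  · rw [Function.comp_apply, e]
    have := pow_pos hlow' 2
    linarith
  · rw [Function.comp_apply, polyFun_ratCast, hval, hF, sub_self]
  · have := (hasDerivAt_polyFun (profileNode c) q).sub hF'
    rwa [hder, sub_self] at this

theorem IsHermiteInterpolant.nodup {cs q : List ℚ} (h : IsHermiteInterpolant cs q) :
    ((cs.map profileNode).map ((↑) : ℚ → ℝ)).Nodup :=
  h.1.map Rat.cast_injective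

theorem le_on_Icc_of_le_on_Ico {f g : ℝ → ℝ} (hf : Continuous f) (hg : Continuous g)
    (h : ∀ r, 0 ≤ r → r < 1 → f r ≤ g r) {r : ℝ} (h0 : 0 ≤ r) (h1 : r ≤ 1) : f r ≤ g r := by
  have hsub : closure (Set.Ico (0 : ℝ) 1) ⊆ {r | f r ≤ g r} :=
    closure_minimal (fun s hs => h s hs.1 hs.2) (isClosed_le hf hg)
  rw [closure_Ico zero_ne_one] at hsub
  exact hsub ⟨h0, h1⟩

theorem IsHermiteInterpolant.sqrtProfile_le {cs q : List ℚ} (h : IsHermiteInterpolant cs q)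
    (hcs : 0 < cs.length) (hq : q.length ≤ 2 * cs.length) {r : ℝ} (h0 : 0 ≤ r) (h1 : r ≤ 1) :
    sqrtProfile r ≤ polyFun q r := by
  refine le_on_Icc_of_le_on_Ico continuous_sqrtProfile (continuous_polyFun q)
    (fun s hs0 hs1 => sub_nonneg.1 ?_) h0 h1
  exact HasNonnegTail.nonneg_of_double_zeros h.nodup
    (hasNonnegTail_polyFun_sub_sqrtProfile (by simpa using hq) (by simpa using hcs))
    h.double_zeros hs0 hs1

theorem IsHermiteInterpolant.le_sqrtProfile {cs q : List ℚ} (h : IsHermiteInterpolant cs q)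
    (hq : q.length ≤ 1 + 2 * cs.length) (hq1 : 2 * polyEval 1 q ^ 2 ≤ 1) {r : ℝ} (h0 : 0 ≤ r)
    (h1 : r ≤ 1) : polyFun q r ≤ sqrtProfile r := by
  refine le_on_Icc_of_le_on_Ico (continuous_polyFun q) continuous_sqrtProfile
    (fun s hs0 hs1 => sub_nonpos.1 ?_) h0 h1
  refine HasNonnegTail.nonpos_of_double_zeros h.nodup
    (hasNonnegTail_polyFun_sub_sqrtProfile (by simpa using hq) (by omega))
    h.double_zeros ?_
    ((continuous_polyFun q).sub continuous_sqrtProfile).continuousAt hs0 hs1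
  have e1 := polyFun_ratCast 1 q
  rw [Rat.cast_one] at e1
  -- The profile equals `√(1 / 2)` at `1`, which is what `hq1` is compared with.
  rw [e1, sub_nonpos, sqrtProfile, sub_self, Real.sqrt_zero, add_zero]
  refine Real.le_sqrt_of_sq_le ?_
  have : (2 * (polyEval 1 q : ℝ) ^ 2) ≤ 1 := by exact_mod_cast hq1
  linarith

theorem hexDispersion_div_mem (x y : ℝ) :
    0 ≤ hexDispersion x y / 9 ∧ hexDispersion x y / 9 ≤ 1 := by
  have h0 := hexDispersion_nonneg x y
  have h9 := hexDispersion_le x y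
  constructor <;> linarith

theorem continuous_sqrtProfile_hexDispersion :
    Continuous (Function.uncurry fun x y => sqrtProfile (hexDispersion x y / 9)) :=
  continuous_sqrtProfile.comp (continuous_hexDispersion.div_const 9)

theorem hexLELDensity_le_of_hermite {cs q : List ℚ} (h : IsHermiteInterpolant cs q)
    (hcs : 0 < cs.length) (hq : q.length ≤ 2 * cs.length) {u : ℚ} (hu : polyMean 0 q ≤ u) :
    hexLELDensity ≤ √3 * u := by
  have hu' : (polyMean 0 q : ℝ) ≤ u := by exact_mod_cast hu
  refine le_trans ?_ (mul_le_mul_of_nonneg_left hu' (Real.sqrt_nonneg 3))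
  rw [hexLELDensity_eq_torusMean, ← torusMean_polyFun]
  gcongr
  exact torusMean_mono continuous_sqrtProfile_hexDispersion (continuous_polyFun_hexDispersion q)
    fun x y => h.sqrtProfile_le hcs hq (hexDispersion_div_mem x y).1 (hexDispersion_div_mem x y).2

theorem le_hexLELDensity_of_hermite {cs q : List ℚ} (h : IsHermiteInterpolant cs q)
    (hq : q.length ≤ 1 + 2 * cs.length) (hq1 : 2 * polyEval 1 q ^ 2 ≤ 1) {l : ℚ}
    (hl : l ≤ polyMean 0 q) : √3 * l ≤ hexLELDensity := by
  have hl' : (l : ℝ) ≤ polyMean 0 q := by exact_mod_cast hl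
  refine (mul_le_mul_of_nonneg_left hl' (Real.sqrt_nonneg 3)).trans ?_
  rw [hexLELDensity_eq_torusMean, ← torusMean_polyFun]
  gcongr
  exact torusMean_mono (continuous_polyFun_hexDispersion q) continuous_sqrtProfile_hexDispersion
    fun x y => h.le_sqrtProfile hq hq1 (hexDispersion_div_mem x y).1 (hexDispersion_div_mem x y).2

end HermiteBounds

/-! ### Explicit interpolants and the numerical value -/

section DividedDifferences

/-- From the divided differences of order `k` to those of order `k + 1`; `ts` lists the pairs of
end points. -/
def divDiffStep : List (ℚ × ℚ) → List ℚ → List ℚ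
  | (t, t') :: ts, a :: b :: v => (b - a) / (t' - t) :: divDiffStep ts (b :: v)
  | _, _ => []

/-- The leading divided differences of orders `k, k + 1, …` with respect to the nodes `ts`, from
the list of all those of order `k`; `us` is `ts` without its first `k` entries. -/
def leadingDivDiffs (ts : List ℚ) : ℕ → List ℚ → List ℚ → List ℚ
  | n + 1, us, a :: v =>
      a :: leadingDivDiffs ts n us.tail (divDiffStep (ts.zip us.tail) (a :: v))
  | _, _, _ => []

/-- The divided differences of order one of `sqrtProfile` with respect to doubled nodes. -/
def profileDivDiffs : List ℚ → List ℚ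
  | c :: c' :: cs => profileSlope c ::
      (c' - c) / (profileNode c' - profileNode c) :: profileDivDiffs (c' :: cs)
  | [c] => [profileSlope c]
  | [] => []

/-- Each entry of the list twice. -/
def duplicateEach (l : List ℚ) : List ℚ := l.flatMap fun c => [c, c]

/-- Coefficientwise sum. -/
def polyAdd : List ℚ → List ℚ → List ℚ
  | a :: p, b :: q => (a + b) :: polyAdd p q
  | [], q => q
  | p, [] => p

/-- Product with `X - t`. -/
def polyMulXSub (t : ℚ) (q : List ℚ) : List ℚ :=
  List.zipWith (· - ·) (0 :: q) (q.map (t * ·) ++ [0])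

/-- Coefficients of `d₀ + (X - t₀) (d₁ + (X - t₁) (d₂ + ⋯))`. -/
def newtonForm : List ℚ → List ℚ → List ℚ
  | d :: ds, t :: ts => polyAdd [d] (polyMulXSub t (newtonForm ds ts))
  | _, _ => []

/-- Hermite interpolation of `sqrtProfile` where it takes the values `cs`. -/
def hermiteForm (cs : List ℚ) : List ℚ :=
  let ts := duplicateEach (cs.map profileNode)
  newtonForm (cs.headD 0 :: leadingDivDiffs ts ts.length ts.tail (profileDivDiffs cs)) ts

/-- Hermite interpolation of `sqrtProfile` where it takes the values `cs`, with the value `v`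
at `1`. -/
def hermiteFormAtOne (v : ℚ) (cs : List ℚ) : List ℚ :=
  let ts := duplicateEach (cs.map profileNode)
  let ω := newtonForm (List.replicate ts.length 0 ++ [1]) (ts ++ [0])
  let q := hermiteForm cs
  polyAdd q (ω.map fun a => (v - polyEval 1 q) / polyEval 1 ω * a)

/-- Values of `sqrtProfile` at nodes close to those of a Gauss quadrature. -/
def upperNodes : List ℚ :=
  [3/4, 4/5, 16/19, 15/17, 21/23, 16/17, 26/27, 50/51, 108/109, 555/556]

/-- Values of `sqrtProfile` at nodes close to those of a Gauss–Radau quadrature. -/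
def lowerNodes : List ℚ :=
  [23/31, 17/22, 4/5, 19/23, 17/20, 7/8, 17/19, 21/23, 27/29, 17/18, 23/24, 32/33, 48/49, 73/74,
    131/132, 316/317, 1633/1634]

-- The divided-difference algorithm needs no correctness proof: only its output is used, and the
-- interpolation conditions are checked directly in rational arithmetic.
set_option maxRecDepth 100000 in
theorem isHermiteInterpolant_upper :
    IsHermiteInterpolant upperNodes (hermiteForm upperNodes) := by
  decide +kernel

set_option maxRecDepth 100000 in
theorem isHermiteInterpolant_lower :
    IsHermiteInterpolant lowerNodes (hermiteFormAtOne (707106 / 1000000) lowerNodes) := by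
  decide +kernel

/-- The required accuracy leaves a window of width about `2.9e-5` for the mean of the profile; this
bound and the next one lie just inside its two ends. -/
theorem hexLELDensity_le : hexLELDensity ≤ √3 * (944385 / 1000000 : ℚ) :=
  hexLELDensity_le_of_hermite isHermiteInterpolant_upper (by decide) (by decide +kernel)
    (by decide +kernel)

/-- The value prescribed at `1` is `0.707106`, a rational number slightly below `1 / √2`, as the
lower bound requires. -/
theorem le_hexLELDensity : √3 * (944358 / 1000000 : ℚ) ≤ hexLELDensity :=
  le_hexLELDensity_of_hermite isHermiteInterpolant_lower (by decide +kernel) (by decide +kernel)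
    (by decide +kernel)

theorem abs_two_mul_hexLELDensity_sub_le : |2 * hexLELDensity - 3.2714| ≤ 0.00005 := by
  have h1 := hexLELDensity_le
  have h2 := le_hexLELDensity
  push_cast at h1 h2
  have h3 : √3 ≤ 1.7320509 := Real.sqrt_le_iff.2 (by norm_num)
  have h4 : 1.7320508 ≤ √3 := Real.le_sqrt_of_sq_le (by norm_num)
  rw [abs_le]
  constructor <;> norm_num at * <;> linarith

end DividedDifferences

theorem theorem4p1 :
    (HasIteratedLimit (fun m n : ℕ => LEL (hexTorus m n) / (2 * ((m : ℝ) + 1) * ((n : ℝ) + 1)))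
        hexLELDensity ∧
      HasIteratedLimit (fun m n : ℕ => LEL (hexCylinder m n) / (2 * ((m : ℝ) + 1) * ((n : ℝ) + 1)))
        hexLELDensity ∧
      HasIteratedLimit (fun m n : ℕ => LEL (hexFree m n) / (2 * ((m : ℝ) + 1) * ((n : ℝ) + 1)))
        hexLELDensity ∧
      |hexLELDensity - 1.6357| ≤ 0.00005) ∧
    ((fun p : ℕ × ℕ => LEL (hexTorus p.1 p.2)) ~[atTop]
        (fun p : ℕ × ℕ => 2 * hexLELDensity * ((p.1 : ℝ) + 1) * ((p.2 : ℝ) + 1)) ∧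
      (fun p : ℕ × ℕ => LEL (hexCylinder p.1 p.2)) ~[atTop]
        (fun p : ℕ × ℕ => 2 * hexLELDensity * ((p.1 : ℝ) + 1) * ((p.2 : ℝ) + 1)) ∧
      (fun p : ℕ × ℕ => LEL (hexFree p.1 p.2)) ~[atTop]
        (fun p : ℕ × ℕ => 2 * hexLELDensity * ((p.1 : ℝ) + 1) * ((p.2 : ℝ) + 1)) ∧
      |2 * hexLELDensity - 3.2714| ≤ 0.00005) := by
  have hval := abs_two_mul_hexLELDensity_sub_le
  have hval' : |hexLELDensity - 1.6357| ≤ 0.00005 := by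
    rw [abs_le] at hval ⊢
    constructor <;> norm_num at * <;> linarith
  have hne : hexLELDensity ≠ 0 := by
    intro h
    rw [h] at hval
    norm_num at hval
  have ht := tendsto_normalized_hexTorus
  have hc := tendsto_normalized_hexCylinder ht
  have hf := tendsto_normalized_hexFree hc
  exact ⟨⟨.of_tendsto ht exists_tendsto_normalized_hexTorus,
    .of_tendsto hc exists_tendsto_normalized_hexCylinder,
    .of_tendsto hf exists_tendsto_normalized_hexFree, hval'⟩,
    isEquivalent_of_tendsto_normalized hne ht, isEquivalent_of_tendsto_normalized hne hc,
    isEquivalent_of_tendsto_normalized hne hf, hval⟩
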